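/- Let $t$ and $x=(x^1,\dots,x^n)$ be independent variables and $u$ a scalar dependent variable. A differential function is a smooth function of $t$, $x$, $u$ and finitely many derivatives $u_J$ of $u$, on a fixed open domain $\Omega$ of jet space described by $t,x,u$ and the $x$-derivatives of $u$ only (for example, all of jet space). Operators are linear differential operators $W=\sum_J W^J D_J$ in total derivatives whose finitely many nonzero coefficients $W^J$ are differential functions; $W^*=\sum_J(-1)^{|J|}D_J\circ W^J$ is the formal adjoint, $f'=\sum_J (\partial f/\partial u_J) D_J$ is the Frechet derivative, $E_u(f)=\sum_J(-1)^{|J|}D_J(\partial f/\partial u_J)$ is the Euler–Lagrange operator, $\mathrm{pr}\,X_P f=f'(P)$ is the prolongation of $X_P=P\,\partial_u$, and $\mathrm{pr}\,X_P W=\sum_J (\mathrm{pr}\,X_P W^J) D_J$. Consider an evolution equation $G:=u_t-g=0$ with $g$ a differential function of $t$, $x$, $u$ and $x$-derivatives of $u$. Let $\mathcal E$ be its space of formal solutions, i.e. the set of points of the infinite jet space (over $\Omega$) where $G$ and all its total derivatives vanish. A differential function $P$ is a symmetry if $G'(P)|_{\mathcal E}=0$; $Q$ is an adjoint-symmetry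 if $G'^*(Q)|_{\mathcal E}=0$; $Q$ is a (conservation law) multiplier if $E_u(QG)=0$ identically. **Theorem.** Let $Q$ be an adjoint-symmetry of $u_t=g$ which contains no $t$-derivatives of $u$ and is not a multiplier. Then there is an operator $R_Q$, with coefficients free of $t$-derivatives of $u$, such that $G'^*(Q)=R_Q(G)$ holds identically (off of $\mathcal E$). For every such $R_Q$, the operator $S:=R_Q^*+Q'$ maps symmetries to adjoint-symmetries and has the skew-symmetric form $$S=Q'-Q'^*=-S^*.$$ Moreover, for every symmetry $P$ that contains no $t$-derivatives of $u$, the adjoint-symmetry $S(P)$ is a multiplier if and only if the operator identity $$\mathrm{pr}\,X_P S+S P'+P'^*S=0$$ holds. -/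

import Mathlib

open scoped ContDiff

noncomputable section

namespace EvolutionJet

/-- Multi-indices of differentiation in the independent variables `(t, x¹, …, xⁿ)`: the entry `0`
counts `t`-derivatives, the entries `1, …, n` count `xⁱ`-derivatives. -/
abbrev MultiIndex (n : ℕ) : Type := Fin (n + 1) →₀ ℕ

/-- Coordinates of jet space: the independent variables `Sum.inl i` (with `i = 0` being `t`) and
the derivative variables `Sum.inr K`, that is `u_K` (with `u_0 = u`). -/
abbrev JetCoord (n : ℕ) : Type := Fin (n + 1) ⊕ MultiIndex n

/-- The jet space `J = (t, x, u, ∂u, ∂²u, …)`, with the product topology. -/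
abbrev Jet (n : ℕ) : Type := JetCoord n → ℝ

/-- The coordinates `t, xⁱ, u_K` where `K` contains no `t`-derivative. -/
def IsSpatialCoord {n : ℕ} : JetCoord n → Prop
  | Sum.inl _ => True
  | Sum.inr K => K 0 = 0

/-- A domain in jet space that is described by `t`, `x`, `u` and the spatial derivatives of `u`
only (no condition on the `t`-derivatives of `u`). The whole jet space is one. -/
def IsSpatialDomain {n : ℕ} (Ω : TopologicalSpace.Opens (Jet n)) : Prop :=
  ∀ z ∈ Ω, ∀ w : Jet n, (∀ c, IsSpatialCoord c → w c = z c) → w ∈ Ω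

variable {n : ℕ} {Ω : TopologicalSpace.Opens (Jet n)}

/-- `f` is a smooth function on `Ω` of finitely many jet coordinates. -/
def IsDiffFun (f : Ω → ℝ) : Prop :=
  ∃ (s : Finset (JetCoord n)) (F : (s → ℝ) → ℝ),
    (∀ z : Ω, ContDiffAt ℝ ∞ F (s.restrict z.1)) ∧ ∀ z : Ω, f z = F (s.restrict z.1)

/-- The partial derivative with respect to the jet coordinate `c`, at points of the open set `Ω`
(the values given to `f` outside `Ω` are irrelevant). -/
def partialFun (c : JetCoord n) (f : Ω → ℝ) (z : Ω) : ℝ :=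
  deriv (fun r : ℝ => Function.extend Subtype.val f 0 (Function.update z.1 c r)) (z.1 c)

theorem contDiffAt_enlarge {s s' : Finset (JetCoord n)} (h : s ⊆ s') {F : (s → ℝ) → ℝ}
    {z : Jet n} (hF : ContDiffAt ℝ ∞ F (s.restrict z)) :
    ContDiffAt ℝ ∞ (fun v : s' → ℝ => F (fun i => v ⟨i.1, h i.2⟩)) (s'.restrict z) := by
  have h1 : ContDiffAt ℝ ∞ (fun (v : s' → ℝ) (i : s) => v ⟨i.1, h i.2⟩) (s'.restrict z) := by
    fun_prop
  exact ContDiffAt.comp (s'.restrict z) (g := F) hF h1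

theorem IsDiffFun.map₂ {f g : Ω → ℝ} (hf : IsDiffFun f) (hg : IsDiffFun g)
    {op : ℝ → ℝ → ℝ} (hop : ContDiff ℝ ∞ (fun p : ℝ × ℝ => op p.1 p.2)) :
    IsDiffFun (fun z => op (f z) (g z)) := by
  obtain ⟨s, F, hF, hfF⟩ := hf
  obtain ⟨s', F', hF', hfF'⟩ := hg
  have h1 : s ⊆ s ∪ s' := Finset.subset_union_left
  have h2 : s' ⊆ s ∪ s' := Finset.subset_union_right
  refine ⟨s ∪ s', fun v => op (F fun i => v ⟨i.1, h1 i.2⟩) (F' fun i => v ⟨i.1, h2 i.2⟩),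
    fun z => ?_, fun z => ?_⟩
  · exact hop.contDiffAt.comp _
      ((contDiffAt_enlarge h1 (hF z)).prodMk (contDiffAt_enlarge h2 (hF' z)))
  · simp only [hfF, hfF']
    rfl

theorem isDiffFun_const (a : ℝ) : IsDiffFun (fun _ : Ω => a) :=
  ⟨∅, fun _ => a, fun _ => contDiffAt_const, fun _ => rfl⟩

theorem isDiffFun_coord (c : JetCoord n) : IsDiffFun (fun z : Ω => z.1 c) :=
  ⟨{c}, fun v => v ⟨c, Finset.mem_singleton_self c⟩, fun _ => by fun_prop, fun _ => rfl⟩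

theorem extend_update_eventuallyEq {s : Finset (JetCoord n)} {F : (s → ℝ) → ℝ} {f : Ω → ℝ}
    (hf : ∀ z : Ω, f z = F (s.restrict z.1)) (c : JetCoord n) (z : Ω) :
    (fun r : ℝ => Function.extend Subtype.val f 0 (Function.update z.1 c r))
      =ᶠ[nhds (z.1 c)] fun r => F (s.restrict (Function.update z.1 c r)) := by
  have hcont : Continuous fun r : ℝ => Function.update z.1 c r :=
    continuous_const.update c continuous_id
  have hmem : ∀ᶠ r in nhds (z.1 c), Function.update z.1 c r ∈ Ω := by
    apply hcont.continuousAt.eventually_mem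
    rw [Function.update_eq_self]
    exact Ω.isOpen.mem_nhds z.2
  filter_upwards [hmem] with r hr
  exact (Subtype.val_injective.extend_apply f 0 ⟨_, hr⟩).trans (hf ⟨_, hr⟩)

theorem partialFun_of_mem {s : Finset (JetCoord n)} {F : (s → ℝ) → ℝ} {f : Ω → ℝ}
    (hF : ∀ z : Ω, ContDiffAt ℝ ∞ F (s.restrict z.1))
    (hf : ∀ z : Ω, f z = F (s.restrict z.1)) {c : JetCoord n} (hc : c ∈ s) (z : Ω) :
    partialFun c f z = fderiv ℝ F (s.restrict z.1) (Pi.single ⟨c, hc⟩ 1) := by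
  unfold partialFun
  rw [(extend_update_eventuallyEq hf c z).deriv_eq]
  have h1 : ∀ r, s.restrict (Function.update z.1 c r)
      = Function.update (s.restrict z.1) ⟨c, hc⟩ r := by
    intro r
    ext i
    by_cases hi : i = ⟨c, hc⟩
    · subst hi; simp
    · have hi' : i.1 ≠ c := fun h => hi (Subtype.ext h)
      simp [hi, hi']
  simp only [h1]
  have h2 : HasDerivAt (fun r => Function.update (s.restrict z.1) ⟨c, hc⟩ r)
      (Pi.single ⟨c, hc⟩ 1) (z.1 c) := hasDerivAt_update _ _ _
  have h3 : HasFDerivAt F (fderiv ℝ F (s.restrict z.1))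
      (Function.update (s.restrict z.1) ⟨c, hc⟩ (z.1 c)) := by
    have : Function.update (s.restrict z.1) ⟨c, hc⟩ (z.1 c) = s.restrict z.1 :=
      Function.update_eq_self (⟨c, hc⟩ : s) (s.restrict z.1)
    rw [this]
    exact ((hF z).differentiableAt (by simp)).hasFDerivAt
  exact (h3.comp_hasDerivAt _ h2).deriv

theorem partialFun_of_notMem {s : Finset (JetCoord n)} {F : (s → ℝ) → ℝ} {f : Ω → ℝ}
    (hf : ∀ z : Ω, f z = F (s.restrict z.1)) {c : JetCoord n} (hc : c ∉ s) (z : Ω) :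
    partialFun c f z = 0 := by
  unfold partialFun
  rw [(extend_update_eventuallyEq hf c z).deriv_eq]
  have h1 : ∀ r, s.restrict (Function.update z.1 c r) = s.restrict z.1 := by
    intro r
    ext i
    have hi : i.1 ≠ c := fun h => hc (h ▸ i.2)
    simp [hi]
  simp only [h1, deriv_const]

theorem IsDiffFun.partialFun {f : Ω → ℝ} (hf : IsDiffFun f) (c : JetCoord n) :
    IsDiffFun (partialFun c f) := by
  obtain ⟨s, F, hF, hfF⟩ := hf
  by_cases hc : c ∈ s
  · refine ⟨s, fun v => fderiv ℝ F v (Pi.single ⟨c, hc⟩ 1), fun z => ?_,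
      partialFun_of_mem hF hfF hc⟩
    exact ((hF z).fderiv_right (by simp)).clm_apply contDiffAt_const
  · have : EvolutionJet.partialFun c f = fun _ => 0 := funext (partialFun_of_notMem hfF hc)
    rw [this]
    exact isDiffFun_const 0

variable (Ω) in
/-- The algebra of differential functions on `Ω`. -/
def DiffFun : Subalgebra ℝ (Ω → ℝ) where
  carrier := {f | IsDiffFun f}
  mul_mem' hf hg := hf.map₂ hg (op := fun a b => a * b) (by fun_prop)
  add_mem' hf hg := hf.map₂ hg (op := fun a b => a + b) (by fun_prop)
  algebraMap_mem' a := isDiffFun_const a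

/-- The value of a differential function at a point. -/
def eval (f : DiffFun Ω) (z : Ω) : ℝ := f.1 z

/-- A jet coordinate as a differential function. -/
def coord (c : JetCoord n) : DiffFun Ω := ⟨fun z => z.1 c, isDiffFun_coord c⟩

/-- The derivative variable `u_K` as a differential function. -/
def u (K : MultiIndex n) : DiffFun Ω := coord (Sum.inr K)

/-- `∂f/∂c` for a jet coordinate `c`. -/
def pd (c : JetCoord n) (f : DiffFun Ω) : DiffFun Ω := ⟨partialFun c f.1, f.2.partialFun c⟩

theorem finite_support_pd (f : DiffFun Ω) :
    (Function.support fun K : MultiIndex n => pd (Sum.inr K) f).Finite := by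
  obtain ⟨s, F, hF, hfF⟩ := f.2
  refine (s.finite_toSet.preimage (f := fun K : MultiIndex n => (Sum.inr K : JetCoord n))
    Sum.inr_injective.injOn).subset fun K hK => ?_
  by_contra hc
  exact hK (Subtype.ext (funext (partialFun_of_notMem hfF hc)))

variable (Ω) in
/-- Linear differential operators in total derivatives `∑_J W^J D_J`, given by their finitely many
nonzero coefficients `W^J`. -/
abbrev LDO : Type := MultiIndex n →₀ DiffFun Ω

/-- The Frechet derivative `f' = ∑_K (∂f/∂u_K) D_K`. -/
def frechet (f : DiffFun Ω) : LDO Ω :=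
  Finsupp.ofSupportFinite (fun K => pd (Sum.inr K) f) (finite_support_pd f)

/-- The total derivative `D_i = ∂_{x^i} + ∑_K u_{i,K} ∂_{u_K}` (with `i = 0` being `D_t`). -/
def totalD (i : Fin (n + 1)) (f : DiffFun Ω) : DiffFun Ω :=
  pd (Sum.inl i) f + (frechet f).sum fun K a => u (K + Finsupp.single i 1) * a

/-- Iterate `op i` as many times as `K i`, for all `i`. -/
def iterOver {α : Type} (op : Fin (n + 1) → α → α) (K : MultiIndex n) (a : α) : α :=
  (List.finRange (n + 1)).foldr (fun i b => (op i)^[K i] b) a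

/-- `D_K = D_t^{K 0} D_{x^1}^{K 1} ⋯ D_{x^n}^{K n}`. -/
def multiD (K : MultiIndex n) (f : DiffFun Ω) : DiffFun Ω := iterOver totalD K f

/-- The function `W(f) = ∑_J W^J D_J f`. -/
def LDO.app (W : LDO Ω) (f : DiffFun Ω) : DiffFun Ω := W.sum fun J a => a * multiD J f

/-- The composition `D_i ∘ W = ∑_J (D_i W^J) D_J + W^J D_{i,J}`. -/
def LDO.totalDComp (i : Fin (n + 1)) (W : LDO Ω) : LDO Ω :=
  W.sum fun J a => Finsupp.single J (totalD i a) + Finsupp.single (J + Finsupp.single i 1) a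

/-- The composition `D_K ∘ W`. -/
def LDO.multiDComp (K : MultiIndex n) (W : LDO Ω) : LDO Ω := iterOver LDO.totalDComp K W

/-- The composition `V ∘ W = ∑_J V^J (D_J ∘ W)`. -/
def LDO.comp (V W : LDO Ω) : LDO Ω := V.sum fun J a => a • LDO.multiDComp J W

/-- The formal adjoint `W* = ∑_J (-1)^{|J|} D_J ∘ W^J`. -/
def LDO.adjoint (W : LDO Ω) : LDO Ω :=
  W.sum fun J a => (-1 : ℤ) ^ J.degree • LDO.multiDComp J (Finsupp.single 0 a)

/-- The action of the prolongation of `P ∂_u` on differential functions,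
`pr X_P f = ∑_K (D_K P) ∂f/∂u_K`. -/
def prX (P f : DiffFun Ω) : DiffFun Ω := (frechet f).sum fun K a => multiD K P * a

/-- The action of the prolongation of `P ∂_u` on the coefficients of an operator. -/
def LDO.prX (P : DiffFun Ω) (W : LDO Ω) : LDO Ω :=
  W.sum fun J a => Finsupp.single J (EvolutionJet.prX P a)

/-- The Euler-Lagrange operator `E_u(f) = ∑_K (-1)^{|K|} D_K (∂f/∂u_K)`. -/
def euler (f : DiffFun Ω) : DiffFun Ω :=
  (frechet f).sum fun K a => (-1 : ℤ) ^ K.degree • multiD K a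

/-- `f` vanishes on the space of formal solutions of `G = 0`, the points of (infinite) jet space
at which `G` and all its total derivatives vanish. -/
def VanishesOnSolutions (G f : DiffFun Ω) : Prop :=
  ∀ z : Ω, (∀ K, eval (multiD K G) z = 0) → eval f z = 0

/-- `P` is (the characteristic function of) a symmetry of `G = 0`: `pr X_P G = 0` on solutions. -/
def IsSymmetry (G P : DiffFun Ω) : Prop := VanishesOnSolutions G (prX P G)

/-- `Q` is an adjoint-symmetry of `G = 0`: `G'*(Q) = 0` on solutions. -/
def IsAdjointSymmetry (G Q : DiffFun Ω) : Prop :=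
  VanishesOnSolutions G ((frechet G).adjoint.app Q)

/-- `Q` is a conservation law multiplier of `G = 0`: `E_u(Q G) = 0` identically. -/
def IsMultiplier (G Q : DiffFun Ω) : Prop := euler (Q * G) = 0

/-- `f` depends only on `t`, `x`, `u` and the spatial derivatives of `u`. -/
def IsTFree (f : DiffFun Ω) : Prop :=
  ∀ z w : Ω, (∀ c, IsSpatialCoord c → z.1 c = w.1 c) → eval f z = eval f w

/-- `G = u_t - g`. -/
def evolutionPDE (g : DiffFun Ω) : DiffFun Ω := u (Finsupp.single 0 1) - g

/-- `R` is an operator `R_Q` for the adjoint-symmetry `Q` of `G = 0`: the identity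
`G'*(Q) = R(G)` holds off of the solution space. The coefficients of `R`, like `Q` itself, are free
of `t`-derivatives of `u`. -/
def IsAdjointSymmetryOp (G Q : DiffFun Ω) (R : LDO Ω) : Prop :=
  (∀ J, IsTFree (R J)) ∧ (frechet G).adjoint.app Q = R.app G

end EvolutionJet

end

open scoped ContDiff

noncomputable section

namespace EvolutionJet

variable {n : ℕ} {Ω : TopologicalSpace.Opens (Jet n)}

/-! On functions, `D_t` is the time derivative along the flow of `u_t = g` (`evolD`) plus the
prolongation with characteristic `G` itself (`totalD_zero_eq`). Hence `G'*(Q) = -(evolD g Q +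
g'*(Q)) - Q'(G)`. The bracket contains no `t`-derivatives of `u` and vanishes on solutions, where
`t`, `x`, `u` and the spatial derivatives of `u` are free coordinates, so it vanishes identically
and `G'*(Q) = -Q'(G)`. An operator with coefficients free of `t`-derivatives of `u` is determined by
its value on `G`, as the highest `t`-derivatives show (`LDO.eq_zero_of_app_evolutionPDE`). So `R_Q =
-Q'` is forced, and `S = Q' - Q'*`.

The relation `G'*(Q) = -Q'(G)` holds off of the solution space, so it can be linearized. Subtracting
from its Frechet derivative the adjoint of that derivative gives `G'* S + S G' + pr X_G S = 0`,
because the term with second derivatives of `G` is self-adjoint (`LDO.adjoint_adjoint_frechet_lin`)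
and cancels. Applied to a symmetry `P`, the last two terms vanish on solutions, hence so does
`G'*(S(P))`.

Finally `E_u(QG) = G'*(Q) + Q'*(G) = -(Q' - Q'*)(G)`, so an adjoint-symmetry free of `t`-derivatives
is a multiplier exactly when its Frechet derivative is self-adjoint (`isMultiplier_iff`). The skew
part of `S(P)'` is the operator in the theorem, by the same cancellation of second derivatives
(`frechet_skew_app_sub_adjoint`).

Two tools run throughout: operators are compared through their action on functions (`LDO.ext_app`),
and vanishing on solutions is tested by a retraction onto the solution space
(`vanishesOnSolutions_iff`). -/

/-! ### Calculus of partial derivatives on `Ω` -/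

/-- The chain rule along a curve in jet space all of whose components are differentiable. -/
theorem hasDerivAt_extend_comp {s : Finset (JetCoord n)} {F : (s → ℝ) → ℝ} {f : Ω → ℝ}
    (hF : ∀ z : Ω, ContDiffAt ℝ ∞ F (s.restrict z.1))
    (hf : ∀ z : Ω, f z = F (s.restrict z.1)) {γ : ℝ → Jet n} {X : Jet n} {r₀ : ℝ} {z : Ω}
    (hz : γ r₀ = z.1) (hγ : ∀ c, HasDerivAt (fun r => γ r c) (X c) r₀) :
    HasDerivAt (fun r => Function.extend Subtype.val f 0 (γ r))
      (∑ c : s, X c * partialFun c.1 f z) r₀ := by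
  have hcont : ContinuousAt γ r₀ := continuousAt_pi.2 fun c => (hγ c).continuousAt
  have hmem : ∀ᶠ r in nhds r₀, γ r ∈ Ω := by
    apply hcont.eventually_mem
    rw [hz]
    exact Ω.isOpen.mem_nhds z.2
  have heq : (fun r => Function.extend Subtype.val f 0 (γ r)) =ᶠ[nhds r₀]
      fun r => F (s.restrict (γ r)) := by
    filter_upwards [hmem] with r hr
    exact (Subtype.val_injective.extend_apply f 0 ⟨_, hr⟩).trans (hf ⟨_, hr⟩)
  have h2 : HasDerivAt (fun r => s.restrict (γ r)) (s.restrict X) r₀ :=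
    hasDerivAt_pi.2 fun c => hγ c
  have h3 : HasFDerivAt F (fderiv ℝ F (s.restrict z.1)) (s.restrict (γ r₀)) := by
    rw [hz]
    exact ((hF z).differentiableAt (by simp)).hasFDerivAt
  have h4 := (h3.comp_hasDerivAt r₀ h2).congr_of_eventuallyEq heq
  refine h4.congr_deriv ?_
  conv_lhs => rw [pi_eq_sum_univ' (s.restrict X), map_sum]
  refine Finset.sum_congr rfl fun c _ => ?_
  rw [partialFun_of_mem hF hf c.2, map_smul, smul_eq_mul]
  rfl

theorem hasDerivAt_update_apply (z : Jet n) (b c : JetCoord n) :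
    HasDerivAt (fun r => Function.update z b r c) ((Pi.single b 1 : Jet n) c) (z b) := by
  by_cases h : c = b
  · subst h
    simpa using hasDerivAt_id' (z c)
  · simpa [h] using hasDerivAt_const (z b) (z c)

theorem eventually_update_mem (b : JetCoord n) (z : Ω) :
    ∀ᶠ r in nhds (z.1 b), Function.update z.1 b r ∈ Ω := by
  have h : Continuous fun r : ℝ => Function.update z.1 b r := continuous_const.update b continuous_id
  apply h.continuousAt.eventually_mem
  rw [Function.update_eq_self]
  exact Ω.isOpen.mem_nhds z.2

theorem hasDerivAt_pd (c : JetCoord n) (f : DiffFun Ω) (z : Ω) :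
    HasDerivAt (fun r => Function.extend Subtype.val f.1 0 (Function.update z.1 c r))
      (eval (pd c f) z) (z.1 c) := by
  obtain ⟨s, F, hF, hf⟩ := f.2
  have := hasDerivAt_extend_comp hF hf (Function.update_eq_self c z.1)
    (fun b => hasDerivAt_update_apply z.1 c b)
  exact this.differentiableAt.hasDerivAt

theorem DiffFun.ext {f g : DiffFun Ω} (h : ∀ z, eval f z = eval g z) : f = g :=
  Subtype.ext (funext h)

theorem eval_add (f g : DiffFun Ω) (z : Ω) : eval (f + g) z = eval f z + eval g z := rfl

theorem eval_sub (f g : DiffFun Ω) (z : Ω) : eval (f - g) z = eval f z - eval g z := rfl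

theorem eval_neg (f : DiffFun Ω) (z : Ω) : eval (-f) z = -eval f z := rfl

theorem eval_mul (f g : DiffFun Ω) (z : Ω) : eval (f * g) z = eval f z * eval g z := rfl

theorem eval_zero (z : Ω) : eval (0 : DiffFun Ω) z = 0 := rfl

theorem eval_sum {ι : Type*} (s : Finset ι) (f : ι → DiffFun Ω) (z : Ω) :
    eval (∑ i ∈ s, f i) z = ∑ i ∈ s, eval (f i) z := by
  classical
  induction s using Finset.induction_on with
  | empty => rfl
  | insert i s hi ih => rw [Finset.sum_insert hi, Finset.sum_insert hi, eval_add, ih]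

/-- Outside `Ω` every extension takes the default value 0; `hop` makes the two sides agree there
too. -/
theorem extend_map₂ (op : ℝ → ℝ → ℝ) (hop : op 0 0 = 0) (f g : Ω → ℝ) (w : Jet n) :
    Function.extend Subtype.val (fun z => op (f z) (g z)) 0 w
      = op (Function.extend Subtype.val f 0 w) (Function.extend Subtype.val g 0 w) := by
  by_cases hw : w ∈ Ω
  · have h (k : Ω → ℝ) : Function.extend Subtype.val k 0 w = k ⟨w, hw⟩ :=
      Subtype.val_injective.extend_apply k 0 ⟨w, hw⟩
    rw [h, h, h]
  · have h (k : Ω → ℝ) : Function.extend Subtype.val k 0 w = 0 :=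
      Function.extend_apply' k (0 : Jet n → ℝ) w fun ⟨a, ha⟩ => hw (ha ▸ a.2)
    rw [h, h, h, hop]

theorem extend_update_self (f : Ω → ℝ) (c : JetCoord n) (z : Ω) :
    Function.extend Subtype.val f 0 (Function.update z.1 c (z.1 c)) = f z := by
  rw [Function.update_eq_self]
  exact Subtype.val_injective.extend_apply f 0 z

theorem pd_add (c : JetCoord n) (f g : DiffFun Ω) : pd c (f + g) = pd c f + pd c g := by
  refine DiffFun.ext fun z => ?_
  have h := (hasDerivAt_pd c f z).add (hasDerivAt_pd c g z)
  have h' := hasDerivAt_pd c (f + g) z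
  refine h'.unique (h.congr_of_eventuallyEq (Filter.Eventually.of_forall fun r => ?_))
  exact extend_map₂ (fun a b => a + b) (add_zero 0) f.1 g.1 _

theorem pd_mul (c : JetCoord n) (f g : DiffFun Ω) : pd c (f * g) = f * pd c g + g * pd c f := by
  refine DiffFun.ext fun z => ?_
  have h := (hasDerivAt_pd c f z).mul (hasDerivAt_pd c g z)
  have h' := hasDerivAt_pd c (f * g) z
  rw [extend_update_self, extend_update_self] at h
  refine (h'.unique (h.congr_of_eventuallyEq (Filter.Eventually.of_forall fun r => ?_))).trans ?_
  · exact extend_map₂ (fun a b => a * b) (mul_zero 0) f.1 g.1 _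
  · rw [eval_add, eval_mul, eval_mul]
    change _ * eval g z + eval f z * _ = _
    ring

theorem pd_coord (b c : JetCoord n) : pd b (coord (Ω := Ω) c) =
    (Pi.single b 1 : JetCoord n → DiffFun Ω) c := by
  refine DiffFun.ext fun z => ?_
  refine (hasDerivAt_pd b (coord c) z).unique ?_
  have h := hasDerivAt_update_apply z.1 b c
  refine (h.congr_of_eventuallyEq ?_).congr_deriv ?_
  · filter_upwards [eventually_update_mem b z] with r hr
    exact Subtype.val_injective.extend_apply _ (0 : Jet n → ℝ) ⟨_, hr⟩
  · by_cases hc : c = b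
    · subst hc
      simp only [Pi.single_eq_same]
      rfl
    · simp only [Pi.single_eq_of_ne hc]
      rfl

theorem pd_comm (b c : JetCoord n) (f : DiffFun Ω) : pd b (pd c f) = pd c (pd b f) := by
  obtain ⟨s₀, F₀, hF₀, hf₀⟩ := f.2
  -- Adding `b` and `c` to the coordinates of `f` makes both partial derivatives directional
  -- derivatives of a single `F`, so the symmetry of its second derivative applies.
  have hsub : s₀ ⊆ insert b (insert c s₀) := fun i hi => by simp [hi]
  set s := insert b (insert c s₀) with hs
  set F : (s → ℝ) → ℝ := fun v => F₀ fun i => v ⟨i.1, hsub i.2⟩ with hFdef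
  have hF : ∀ z : Ω, ContDiffAt ℝ ∞ F (s.restrict z.1) := fun z => contDiffAt_enlarge hsub (hF₀ z)
  have hf : ∀ z : Ω, f.1 z = F (s.restrict z.1) := hf₀
  have hb : b ∈ s := by simp [hs]
  have hc : c ∈ s := by simp [hs]
  have key (d e : JetCoord n) (hd : d ∈ s) (he : e ∈ s) (z : Ω) : eval (pd d (pd e f)) z
      = fderiv ℝ (fderiv ℝ F) (s.restrict z.1) (Pi.single ⟨d, hd⟩ 1) (Pi.single ⟨e, he⟩ 1) := by
    have h1 : ∀ z : Ω, (pd e f).1 z = fderiv ℝ F (s.restrict z.1) (Pi.single ⟨e, he⟩ 1) :=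
      partialFun_of_mem hF hf he
    have h2 : ∀ z : Ω, ContDiffAt ℝ ∞ (fun v => fderiv ℝ F v (Pi.single ⟨e, he⟩ 1))
        (s.restrict z.1) := fun z =>
      ((hF z).fderiv_right (by simp)).clm_apply contDiffAt_const
    refine (partialFun_of_mem h2 h1 hd z).trans ?_
    have h3 : DifferentiableAt ℝ (fderiv ℝ F) (s.restrict z.1) :=
      ((hF z).fderiv_right (m := ∞) (by simp)).differentiableAt (by simp)
    rw [fderiv_clm_apply h3 (differentiableAt_const _)]
    simp
  refine DiffFun.ext fun z => ?_
  rw [key b c hb hc, key c b hc hb]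
  exact ((hF z).isSymmSndFDerivAt (by simpa using WithTop.coe_le_coe.2 (le_top : (2 : ℕ∞) ≤ ⊤))).eq _ _

theorem pd_zero (c : JetCoord n) : pd c (0 : DiffFun Ω) = 0 := by
  simpa using pd_add c (0 : DiffFun Ω) 0

theorem pd_neg (c : JetCoord n) (f : DiffFun Ω) : pd c (-f) = -pd c f := by
  rw [eq_neg_iff_add_eq_zero, ← pd_add, neg_add_cancel, pd_zero]

theorem pd_sub (c : JetCoord n) (f g : DiffFun Ω) : pd c (f - g) = pd c f - pd c g := by
  rw [sub_eq_add_neg, pd_add, pd_neg, ← sub_eq_add_neg]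

theorem pd_one (c : JetCoord n) : pd c (1 : DiffFun Ω) = 0 := by
  simpa using pd_mul c (1 : DiffFun Ω) 1

theorem pd_sum {ι : Type*} (c : JetCoord n) (s : Finset ι) (f : ι → DiffFun Ω) :
    pd c (∑ i ∈ s, f i) = ∑ i ∈ s, pd c (f i) :=
  map_sum (AddMonoidHom.mk' (pd c) (pd_add c)) f s

theorem exists_finset_pd_eq_zero (f : DiffFun Ω) :
    ∃ s : Finset (JetCoord n), ∀ c ∉ s, pd c f = 0 := by
  obtain ⟨s, F, hF, hf⟩ := f.2
  exact ⟨s, fun c hc => DiffFun.ext fun z => partialFun_of_notMem hf hc z⟩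

/-! ### Vector fields on jet space and their brackets -/

/-- The vector field `∑_c ξ_c ∂_c` on jet space. -/
def vectorField (ξ : JetCoord n → DiffFun Ω) (f : DiffFun Ω) : DiffFun Ω := ∑ᶠ c, ξ c * pd c f

section VectorField

variable (ξ η : JetCoord n → DiffFun Ω)

/-- The set `s` may be larger than needed, so that several functions can be expanded over one common
finite set. -/
theorem vectorField_eq_sum {f : DiffFun Ω} {s : Finset (JetCoord n)}
    (hs : ∀ c ∉ s, pd c f = 0) : vectorField ξ f = ∑ c ∈ s, ξ c * pd c f := by
  refine finsum_eq_sum_of_support_subset _ fun c hc => ?_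
  by_contra h
  exact hc (by simp only [hs c h, mul_zero])

theorem exists_finset_pd_eq_zero₂ (f g : DiffFun Ω) :
    ∃ s : Finset (JetCoord n), (∀ c ∉ s, pd c f = 0) ∧ ∀ c ∉ s, pd c g = 0 := by
  obtain ⟨s, hs⟩ := exists_finset_pd_eq_zero f
  obtain ⟨t, ht⟩ := exists_finset_pd_eq_zero g
  exact ⟨s ∪ t, fun c hc => hs c fun h => hc (Finset.mem_union_left t h),
    fun c hc => ht c fun h => hc (Finset.mem_union_right s h)⟩

theorem vectorField_add (f g : DiffFun Ω) :
    vectorField ξ (f + g) = vectorField ξ f + vectorField ξ g := by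
  obtain ⟨s, hf, hg⟩ := exists_finset_pd_eq_zero₂ f g
  rw [vectorField_eq_sum ξ hf, vectorField_eq_sum ξ hg,
    vectorField_eq_sum ξ (s := s) fun c hc => by rw [pd_add, hf c hc, hg c hc, add_zero],
    ← Finset.sum_add_distrib]
  exact Finset.sum_congr rfl fun c _ => by rw [pd_add, mul_add]

theorem vectorField_mul (f g : DiffFun Ω) :
    vectorField ξ (f * g) = f * vectorField ξ g + g * vectorField ξ f := by
  obtain ⟨s, hf, hg⟩ := exists_finset_pd_eq_zero₂ f g
  rw [vectorField_eq_sum ξ hf, vectorField_eq_sum ξ hg,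
    vectorField_eq_sum ξ (s := s) fun c hc => by rw [pd_mul, hf c hc, hg c hc]; simp,
    Finset.mul_sum, Finset.mul_sum, ← Finset.sum_add_distrib]
  exact Finset.sum_congr rfl fun c _ => by rw [pd_mul]; ring

theorem vectorField_coord (c : JetCoord n) : vectorField ξ (coord c) = ξ c := by
  rw [vectorField_eq_sum ξ (s := {c}) fun b hb => by
    rw [pd_coord, Pi.single_eq_of_ne fun h => hb (by simp [h])]]
  rw [Finset.sum_singleton, pd_coord, Pi.single_eq_same, mul_one]

theorem vectorField_sum {ι : Type*} (s : Finset ι) (f : ι → DiffFun Ω) :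
    vectorField ξ (∑ i ∈ s, f i) = ∑ i ∈ s, vectorField ξ (f i) :=
  map_sum (AddMonoidHom.mk' (vectorField ξ) (vectorField_add ξ)) f s

theorem vectorField_single (b : JetCoord n) (f : DiffFun Ω) :
    vectorField (Pi.single b 1) f = pd b f := by
  classical
  unfold vectorField
  rw [finsum_eq_single _ b fun c hc => by rw [Pi.single_eq_of_ne hc, zero_mul],
    Pi.single_eq_same, one_mul]

/-- The second-order part is symmetric in `ξ` and `η` by `pd_comm`; only the first-order part
survives in the bracket. -/
theorem vectorField_vectorField (f : DiffFun Ω) {s : Finset (JetCoord n)}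
    (hs : ∀ c ∉ s, pd c f = 0) :
    vectorField ξ (vectorField η f)
      = ∑ c ∈ s, ∑ b ∈ s, η c * ξ b * pd b (pd c f) + vectorField (fun c => vectorField ξ (η c)) f := by
  rw [vectorField_eq_sum η hs, vectorField_eq_sum _ hs, vectorField_sum, ← Finset.sum_add_distrib]
  refine Finset.sum_congr rfl fun c _ => ?_
  rw [vectorField_mul, vectorField_eq_sum ξ (f := pd c f) (s := s), Finset.mul_sum]
  · congr 1
    · exact Finset.sum_congr rfl fun b _ => (mul_assoc _ _ _).symm
    · exact mul_comm _ _
  · intro b hb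
    rw [pd_comm, hs b hb, pd_zero]

theorem vectorField_add_left (f : DiffFun Ω) :
    vectorField (fun c => ξ c + η c) f = vectorField ξ f + vectorField η f := by
  obtain ⟨s, hs⟩ := exists_finset_pd_eq_zero f
  rw [vectorField_eq_sum _ hs, vectorField_eq_sum _ hs, vectorField_eq_sum _ hs,
    ← Finset.sum_add_distrib]
  exact Finset.sum_congr rfl fun c _ => add_mul _ _ _

/-- Vector fields commute up to their Lie bracket. -/
theorem vectorField_bracket (f : DiffFun Ω) :
    vectorField ξ (vectorField η f) + vectorField (fun c => vectorField η (ξ c)) f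
      = vectorField η (vectorField ξ f) + vectorField (fun c => vectorField ξ (η c)) f := by
  obtain ⟨s, hs⟩ := exists_finset_pd_eq_zero f
  rw [vectorField_vectorField ξ η f hs, vectorField_vectorField η ξ f hs, Finset.sum_comm]
  have : ∑ y ∈ s, ∑ x ∈ s, η x * ξ y * pd y (pd x f)
      = ∑ c ∈ s, ∑ b ∈ s, ξ c * η b * pd b (pd c f) :=
    Finset.sum_congr rfl fun b _ => Finset.sum_congr rfl fun c _ => by
      rw [pd_comm, mul_comm (η c)]
  rw [this]
  abel

-- This reduces the commutation of `D_i`, `pr X_P` and the flow derivative `evolD` to a check on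
-- coordinates.
variable {ξ η} in
theorem vectorField_commute (h : ∀ c, vectorField ξ (η c) = vectorField η (ξ c))
    (f : DiffFun Ω) : vectorField ξ (vectorField η f) = vectorField η (vectorField ξ f) := by
  have h1 := vectorField_bracket ξ η f
  simp only [h] at h1
  exact add_right_cancel h1

end VectorField

/-! ### Composition with self-maps of `Ω` -/

theorem IsDiffFun.comp_family {s : Finset (JetCoord n)} {F : (s → ℝ) → ℝ}
    (φ : JetCoord n → DiffFun Ω)
    (hF : ∀ z : Ω, ContDiffAt ℝ ∞ F fun c => eval (φ c) z) :
    IsDiffFun fun z : Ω => F fun c => eval (φ c) z := by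
  classical
  choose t H hH hφ using fun c => (φ c).2
  have hsub (c : s) : t c ⊆ s.biUnion t := Finset.subset_biUnion_of_mem t c.2
  refine ⟨s.biUnion t, fun v => F fun c => H c fun i => v ⟨i.1, hsub c i.2⟩, fun z => ?_,
    fun z => ?_⟩
  · have h1 : ContDiffAt ℝ ∞ (fun (v : s.biUnion t → ℝ) (c : s) => H c fun i => v ⟨i.1, hsub c i.2⟩)
        ((s.biUnion t).restrict z.1) :=
      contDiffAt_pi.2 fun c => contDiffAt_enlarge (hsub c) (hH c z)
    refine ContDiffAt.comp (g := F) _ ?_ h1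
    have h2 : (fun c : s => H c fun i => (s.biUnion t).restrict z.1 ⟨i.1, hsub c i.2⟩)
        = fun c : s => eval (φ c) z := funext fun c => (hφ c z).symm
    rw [h2]
    exact hF z
  · exact congrArg F (funext fun c => hφ c z)

theorem isDiffFun_pullback (φ : JetCoord n → DiffFun Ω) (hφ : ∀ z : Ω, (fun c => eval (φ c) z) ∈ Ω)
    (f : DiffFun Ω) : IsDiffFun fun z : Ω => eval f ⟨_, hφ z⟩ := by
  obtain ⟨s, F, hF, hf⟩ := f.2
  have h : (fun z : Ω => eval f ⟨_, hφ z⟩) = fun z => F fun c => eval (φ c) z :=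
    funext fun z => hf ⟨_, hφ z⟩
  rw [h]
  exact IsDiffFun.comp_family φ fun z => hF ⟨_, hφ z⟩

/-- The composition `f ∘ φ` with a self-map `φ` of `Ω` whose components are differential
functions. -/
def pullback (φ : JetCoord n → DiffFun Ω) (hφ : ∀ z : Ω, (fun c => eval (φ c) z) ∈ Ω)
    (f : DiffFun Ω) : DiffFun Ω :=
  ⟨fun z => eval f ⟨_, hφ z⟩, isDiffFun_pullback φ hφ f⟩

section Pullback

variable (φ : JetCoord n → DiffFun Ω) (hφ : ∀ z : Ω, (fun c => eval (φ c) z) ∈ Ω)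

theorem eval_pullback (f : DiffFun Ω) (z : Ω) :
    eval (pullback φ hφ f) z = eval f ⟨_, hφ z⟩ := rfl

theorem pullback_coord (c : JetCoord n) : pullback φ hφ (coord c) = φ c := rfl

/-- Chain rule: the `b`-coordinate line through `z` is mapped by `φ` to a curve with velocity `pd b
(φ c)`. The set `s` depends on `f` alone, so it serves all `b` at once. -/
theorem exists_pd_pullback (f : DiffFun Ω) :
    ∃ s : Finset (JetCoord n), (∀ c ∉ s, pd c f = 0) ∧
      ∀ b, pd b (pullback φ hφ f) = ∑ c ∈ s, pullback φ hφ (pd c f) * pd b (φ c) := by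
  obtain ⟨s, F, hF, hf⟩ := f.2
  refine ⟨s, fun c hc => DiffFun.ext fun z => partialFun_of_notMem hf hc z, fun b => ?_⟩
  refine DiffFun.ext fun z => ?_
  refine (hasDerivAt_pd b (pullback φ hφ f) z).unique ?_
  have h := hasDerivAt_extend_comp (r₀ := z.1 b) (z := ⟨_, hφ z⟩) hF hf
    (γ := fun r c => Function.extend Subtype.val (φ c).1 0 (Function.update z.1 b r))
    (funext fun c => extend_update_self (φ c).1 b z) (fun c => hasDerivAt_pd b (φ c) z)
  refine (h.congr_of_eventuallyEq ?_).congr_deriv ?_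
  · filter_upwards [eventually_update_mem b z] with r hr
    have h1 (k : DiffFun Ω) : Function.extend Subtype.val k.1 0 (Function.update z.1 b r)
        = eval k ⟨_, hr⟩ := Subtype.val_injective.extend_apply k.1 0 ⟨_, hr⟩
    simp only [h1]
    exact (Subtype.val_injective.extend_apply f.1 0 ⟨_, hφ ⟨_, hr⟩⟩).symm
  · rw [eval_sum, Finset.sum_coe_sort s (fun c => eval (pd b (φ c)) z * partialFun c f.1 ⟨_, hφ z⟩)]
    exact Finset.sum_congr rfl fun c _ => mul_comm _ _

/-- Two vector fields that are `φ`-related on coordinates are `φ`-related. -/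
theorem vectorField_pullback {ξ η : JetCoord n → DiffFun Ω}
    (h : ∀ c, vectorField η (φ c) = pullback φ hφ (ξ c)) (f : DiffFun Ω) :
    vectorField η (pullback φ hφ f) = pullback φ hφ (vectorField ξ f) := by
  obtain ⟨s, hs, hpd⟩ := exists_pd_pullback φ hφ f
  have h1 : pullback φ hφ (vectorField ξ f)
      = ∑ c ∈ s, pullback φ hφ (ξ c) * pullback φ hφ (pd c f) := by
    refine DiffFun.ext fun z => ?_
    rw [eval_pullback, vectorField_eq_sum ξ hs, eval_sum, eval_sum]
    rfl
  obtain ⟨t, ht⟩ := exists_finset_pd_eq_zero (pullback φ hφ f)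
  have h2 : vectorField η (pullback φ hφ f)
      = ∑ c ∈ s, pullback φ hφ (pd c f) * vectorField η (φ c) := by
    choose T hT using fun c => exists_finset_pd_eq_zero (φ c)
    classical
    -- A common finite set for the pullback of `f` and for all the components `φ c` with `c ∈ s`.
    set U := t ∪ s.biUnion T
    have hU (c) (hc : c ∈ s) : ∀ b ∉ U, pd b (φ c) = 0 := fun b hb => hT c b fun hb' =>
      hb (Finset.mem_union_right _ (Finset.mem_biUnion.2 ⟨c, hc, hb'⟩))
    rw [vectorField_eq_sum η (s := U) fun b hb => ht b fun hb' => hb (Finset.mem_union_left _ hb')]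
    simp only [hpd, Finset.mul_sum]
    rw [Finset.sum_comm]
    refine Finset.sum_congr rfl fun c hc => ?_
    rw [vectorField_eq_sum η (hU c hc), Finset.mul_sum]
    exact Finset.sum_congr rfl fun b _ => by ring
  rw [h1, h2]
  exact Finset.sum_congr rfl fun c _ => by rw [h, mul_comm]

end Pullback

/-! ### Iterated commuting operators and multi-indices -/

section IterOver

variable {α β : Type} {op : Fin (n + 1) → α → α}

/-- Commutativity moves the extra factor `op i` outwards past the entries preceding `i`. An
arbitrary list without repetitions makes the induction possible. -/
theorem foldr_iterate_add_single (hop : ∀ i j a, op i (op j a) = op j (op i a))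
    (K : MultiIndex n) (i : Fin (n + 1)) (a : α) (l : List (Fin (n + 1))) (hl : l.Nodup) :
    l.foldr (fun j b => (op j)^[(K + Finsupp.single i 1 : MultiIndex n) j] b) a
      = if i ∈ l then op i (l.foldr (fun j b => (op j)^[K j] b) a)
        else l.foldr (fun j b => (op j)^[K j] b) a := by
  induction l with
  | nil => simp
  | cons k l ih =>
    obtain ⟨hk, hl⟩ := List.nodup_cons.1 hl
    rw [List.foldr_cons, ih hl, List.foldr_cons]
    by_cases hik : i = k
    · subst hik
      simp [hk, -Function.iterate_succ, Function.iterate_succ_apply']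
    · have h1 : (K + Finsupp.single i 1 : MultiIndex n) k = K k := by simp [hik]
      rw [h1]
      by_cases hil : i ∈ l
      · rw [if_pos hil, if_pos (List.mem_cons_of_mem _ hil)]
        exact (Function.Semiconj.iterate_right (f := op i) (fun a => hop i k a) _ _).symm
      · rw [if_neg hil, if_neg (by simp [hik, hil])]

theorem iterOver_add_single (hop : ∀ i j a, op i (op j a) = op j (op i a))
    (K : MultiIndex n) (i : Fin (n + 1)) (a : α) :
    iterOver op (K + Finsupp.single i 1) a = op i (iterOver op K a) := by
  unfold iterOver
  rw [foldr_iterate_add_single hop K i a _ (List.nodup_finRange _), if_pos (List.mem_finRange i)]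

theorem iterOver_zero (a : α) : iterOver op (0 : MultiIndex n) a = a := by
  unfold iterOver
  induction List.finRange (n + 1) with
  | nil => rfl
  | cons k l ih => exact ih

/-- The condition `K i ≠ 0` allows properties that only spatial derivatives preserve, when `K 0 =
0`. -/
theorem iterOver_induction {p : α → Prop} (K : MultiIndex n) {a : α} (ha : p a)
    (h : ∀ i b, K i ≠ 0 → p b → p (op i b)) : p (iterOver op K a) := by
  unfold iterOver
  induction List.finRange (n + 1) with
  | nil => exact ha
  | cons k l ih =>
    rw [List.foldr_cons]
    by_cases h0 : K k = 0
    · rw [h0]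
      exact ih
    · have key (m : ℕ) {b : α} (hb : p b) : p ((op k)^[m] b) := by
        induction m with
        | zero => exact hb
        | succ m ihm =>
          rw [Function.iterate_succ_apply']
          exact h k _ h0 ihm
      exact key _ ih

theorem iterOver_semiconj {op' : Fin (n + 1) → β → β} {φ : α → β}
    (h : ∀ i a, φ (op i a) = op' i (φ a)) (K : MultiIndex n) (a : α) :
    φ (iterOver op K a) = iterOver op' K (φ a) := by
  unfold iterOver
  induction List.finRange (n + 1) with
  | nil => rfl
  | cons k l ih =>
    rw [List.foldr_cons, List.foldr_cons, ← ih]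
    exact Function.Semiconj.iterate_right (f := φ) (h k) _ _

end IterOver

theorem MultiIndex.induction {p : MultiIndex n → Prop} (h0 : p 0)
    (h : ∀ K i, p K → p (K + Finsupp.single i 1)) (K : MultiIndex n) : p K := by
  have key (K : MultiIndex n) (i : Fin (n + 1)) (hK : p K) (m : ℕ) :
      p (K + Finsupp.single i m) := by
    induction m with
    | zero => simpa using hK
    | succ m ih =>
      rw [Finsupp.single_add, ← add_assoc]
      exact h _ _ ih
  induction K using Finsupp.induction with
  | zero => exact h0
  | single_add i m K _ _ ih =>
    rw [add_comm]
    exact key K i ih m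

/-! ### Total derivatives and prolongations as vector fields -/

theorem frechet_apply (f : DiffFun Ω) (K : MultiIndex n) : frechet f K = pd (Sum.inr K) f := rfl

theorem vectorField_eq_frechet_sum (ξ : JetCoord n → DiffFun Ω) (f : DiffFun Ω)
    (h : ∀ i, ξ (Sum.inl i) = 0) :
    vectorField ξ f = (frechet f).sum fun K a => ξ (Sum.inr K) * a := by
  have h1 : ∀ c ∉ (frechet f).support.map ⟨Sum.inr, Sum.inr_injective⟩, ξ c * pd c f = 0 := by
    rintro (i | K) hc
    · rw [h, zero_mul]
    · have hK : frechet f K = 0 := by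
        by_contra hK
        exact hc (Finset.mem_map.2 ⟨K, Finsupp.mem_support_iff.2 hK, rfl⟩)
      rw [← frechet_apply, hK, mul_zero]
  unfold vectorField
  rw [finsum_eq_sum_of_support_subset _ (s := (frechet f).support.map
    ⟨Sum.inr, Sum.inr_injective⟩), Finset.sum_map]
  · rfl
  · intro c hc
    by_contra hc'
    exact hc (h1 c hc')

/-- The components of the total derivative `D_i`. -/
def totalDField (i : Fin (n + 1)) : JetCoord n → DiffFun Ω
  | Sum.inl j => (Pi.single i 1 : Fin (n + 1) → DiffFun Ω) j
  | Sum.inr K => u (K + Finsupp.single i 1)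

/-- The components of the prolongation of `P ∂_u`. -/
def prXField (P : DiffFun Ω) : JetCoord n → DiffFun Ω
  | Sum.inl _ => 0
  | Sum.inr K => multiD K P

theorem prX_eq_vectorField (P f : DiffFun Ω) : prX P f = vectorField (prXField P) f := by
  rw [vectorField_eq_frechet_sum _ _ fun i => rfl]
  rfl

theorem totalD_eq_vectorField (i : Fin (n + 1)) (f : DiffFun Ω) :
    totalD i f = vectorField (totalDField i) f := by
  have h : totalDField (Ω := Ω) i = fun c => (Pi.single (Sum.inl i) 1 : JetCoord n → DiffFun Ω) c +
      Sum.elim (fun _ => 0) (fun K => u (K + Finsupp.single i 1)) c := by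
    funext c
    rcases c with j | K
    · by_cases hj : j = i
      · subst hj
        simp [totalDField]
      · simp [totalDField, hj]
    · simp [totalDField]
  rw [h, vectorField_add_left, vectorField_single, vectorField_eq_frechet_sum _ _ fun i => rfl]
  rfl

theorem totalD_add (i : Fin (n + 1)) (f g : DiffFun Ω) :
    totalD i (f + g) = totalD i f + totalD i g := by
  simp only [totalD_eq_vectorField, vectorField_add]

theorem totalD_mul (i : Fin (n + 1)) (f g : DiffFun Ω) :
    totalD i (f * g) = f * totalD i g + g * totalD i f := by
  simp only [totalD_eq_vectorField, vectorField_mul]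

theorem totalD_u (i : Fin (n + 1)) (K : MultiIndex n) :
    totalD i (u K : DiffFun Ω) = u (K + Finsupp.single i 1) := by
  rw [totalD_eq_vectorField, u, vectorField_coord]
  rfl

theorem pd_single_one (c : JetCoord n) (i j : Fin (n + 1)) :
    pd c ((Pi.single i 1 : Fin (n + 1) → DiffFun Ω) j) = 0 := by
  by_cases h : j = i
  · subst h
    rw [Pi.single_eq_same, pd_one]
  · rw [Pi.single_eq_of_ne h, pd_zero]

theorem vectorField_single_one (ξ : JetCoord n → DiffFun Ω) (i j : Fin (n + 1)) :
    vectorField ξ ((Pi.single i 1 : Fin (n + 1) → DiffFun Ω) j) = 0 := by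
  rw [vectorField_eq_sum ξ (s := ∅) fun c _ => pd_single_one c i j, Finset.sum_empty]

theorem vectorField_zero (ξ : JetCoord n → DiffFun Ω) : vectorField ξ (0 : DiffFun Ω) = 0 := by
  rw [vectorField_eq_sum ξ (s := ∅) fun c _ => pd_zero c, Finset.sum_empty]

theorem totalD_comm (i j : Fin (n + 1)) (f : DiffFun Ω) :
    totalD i (totalD j f) = totalD j (totalD i f) := by
  simp only [totalD_eq_vectorField]
  refine vectorField_commute (fun c => ?_) f
  simp only [← totalD_eq_vectorField]
  rcases c with k | K
  · simp only [totalDField, totalD_eq_vectorField, vectorField_single_one]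
  · simp only [totalDField, totalD_u]
    rw [add_right_comm]

theorem multiD_add_single (K : MultiIndex n) (i : Fin (n + 1)) (f : DiffFun Ω) :
    multiD (K + Finsupp.single i 1) f = totalD i (multiD K f) :=
  iterOver_add_single totalD_comm K i f

theorem multiD_zero_index (f : DiffFun Ω) : multiD 0 f = f := iterOver_zero f

theorem multiD_totalD (K : MultiIndex n) (i : Fin (n + 1)) (f : DiffFun Ω) :
    multiD K (totalD i f) = totalD i (multiD K f) :=
  (iterOver_semiconj (φ := totalD i) (fun j a => totalD_comm i j a) K f).symm

theorem multiD_single (i : Fin (n + 1)) (f : DiffFun Ω) :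
    multiD (Finsupp.single i 1) f = totalD i f := by
  rw [← zero_add (Finsupp.single i 1), multiD_add_single, multiD_zero_index]

theorem multiD_add (K : MultiIndex n) (f g : DiffFun Ω) :
    multiD K (f + g) = multiD K f + multiD K g := by
  induction K using MultiIndex.induction with
  | h0 => simp only [multiD_zero_index]
  | h K i ih => rw [multiD_add_single, multiD_add_single, multiD_add_single, ih, totalD_add]

theorem multiD_u (J K : MultiIndex n) : multiD J (u K : DiffFun Ω) = u (K + J) := by
  induction J using MultiIndex.induction with
  | h0 => rw [multiD_zero_index, add_zero]
  | h J i ih => rw [multiD_add_single, ih, totalD_u, add_assoc]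

/-- `D_K` as an additive endomorphism. -/
def multiDHom (K : MultiIndex n) : DiffFun Ω →+ DiffFun Ω := AddMonoidHom.mk' (multiD K) (multiD_add K)

theorem multiD_zero (K : MultiIndex n) : multiD K (0 : DiffFun Ω) = 0 := map_zero (multiDHom K)

theorem multiD_sub (K : MultiIndex n) (f g : DiffFun Ω) :
    multiD K (f - g) = multiD K f - multiD K g := map_sub (multiDHom K) f g

theorem multiD_sum {ι : Type*} (K : MultiIndex n) (s : Finset ι) (f : ι → DiffFun Ω) :
    multiD K (∑ i ∈ s, f i) = ∑ i ∈ s, multiD K (f i) := map_sum (multiDHom K) f s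

theorem totalD_sub (i : Fin (n + 1)) (f g : DiffFun Ω) :
    totalD i (f - g) = totalD i f - totalD i g := by
  rw [← multiD_single, multiD_sub, multiD_single, multiD_single]

theorem prX_add (P f f' : DiffFun Ω) : prX P (f + f') = prX P f + prX P f' := by
  simp only [prX_eq_vectorField, vectorField_add]

theorem prX_mul (P f f' : DiffFun Ω) : prX P (f * f') = f * prX P f' + f' * prX P f := by
  simp only [prX_eq_vectorField, vectorField_mul]

/-- `pr X_P` as an additive endomorphism. -/
def prXHom (P : DiffFun Ω) : DiffFun Ω →+ DiffFun Ω := AddMonoidHom.mk' (prX P) (prX_add P)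

theorem prX_zero (P : DiffFun Ω) : prX P 0 = 0 := map_zero (prXHom P)

theorem prX_neg (P f : DiffFun Ω) : prX P (-f) = -prX P f := map_neg (prXHom P) f

theorem prX_sub (P f f' : DiffFun Ω) : prX P (f - f') = prX P f - prX P f' :=
  map_sub (prXHom P) f f'

theorem prX_zsmul (P : DiffFun Ω) (m : ℤ) (f : DiffFun Ω) : prX P (m • f) = m • prX P f :=
  map_zsmul (prXHom P) m f

theorem prX_u (P : DiffFun Ω) (K : MultiIndex n) : prX P (u K) = multiD K P := by
  rw [prX_eq_vectorField, u, vectorField_coord]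
  rfl

theorem prX_totalD (P : DiffFun Ω) (i : Fin (n + 1)) (f : DiffFun Ω) :
    prX P (totalD i f) = totalD i (prX P f) := by
  simp only [prX_eq_vectorField, totalD_eq_vectorField]
  refine vectorField_commute (fun c => ?_) f
  simp only [← totalD_eq_vectorField, ← prX_eq_vectorField]
  rcases c with k | K
  · simp only [totalDField, prXField, prX_eq_vectorField, vectorField_single_one,
      totalD_eq_vectorField, vectorField_zero]
  · simp only [totalDField, prXField, prX_u, multiD_add_single]

theorem prX_multiD (P : DiffFun Ω) (K : MultiIndex n) (f : DiffFun Ω) :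
    prX P (multiD K f) = multiD K (prX P f) :=
  iterOver_semiconj (φ := prX P) (fun i a => prX_totalD P i a) K f

/-- The bracket of `∂_c` with `D_i`: the components of `∂_c` are constant, so only the term
differentiating the components of `D_i` remains. -/
theorem pd_totalD (c : JetCoord n) (i : Fin (n + 1)) (f : DiffFun Ω) :
    pd c (totalD i f) = totalD i (pd c f) + vectorField (fun b => pd c (totalDField i b)) f := by
  have h := vectorField_bracket (Pi.single c 1) (totalDField i) f
  have h0 : vectorField (fun b => vectorField (totalDField i)
      ((Pi.single c 1 : JetCoord n → DiffFun Ω) b)) f = 0 := by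
    have : (fun b => vectorField (totalDField i)
        ((Pi.single c 1 : JetCoord n → DiffFun Ω) b)) = fun _ => 0 := by
      funext b
      by_cases hb : b = c
      · subst hb
        rw [Pi.single_eq_same, vectorField_eq_sum _ (s := ∅) fun c _ => pd_one c, Finset.sum_empty]
      · rw [Pi.single_eq_of_ne hb, vectorField_zero]
    rw [this, vectorField]
    simp
  rw [h0, add_zero] at h
  simpa only [vectorField_single, ← totalD_eq_vectorField] using h

theorem pd_u (L K : MultiIndex n) :
    pd (Sum.inr L) (u K : DiffFun Ω) = if L = K then 1 else 0 := by
  rw [u, pd_coord]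
  by_cases h : L = K
  · subst h
    simp
  · rw [if_neg h, Pi.single_eq_of_ne]
    exact fun h' => h (Sum.inr_injective h').symm

/-- Every differential function has finite order in `t`. -/
theorem exists_tOrder (f : DiffFun Ω) : ∃ N : ℕ, ∀ K : MultiIndex n, N ≤ K 0 →
    pd (Sum.inr K) f = 0 := by
  refine ⟨(frechet f).support.sup (fun K => K 0) + 1, fun K hK => ?_⟩
  by_contra h
  have h1 : K ∈ (frechet f).support := Finsupp.mem_support_iff.2 h
  have h2 := Finset.le_sup (f := fun K : MultiIndex n => K 0) h1
  change K 0 ≤ _ at h2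
  omega

theorem exists_tOrder_finset {ι : Type*} (s : Finset ι) (f : ι → DiffFun Ω) :
    ∃ N : ℕ, ∀ i ∈ s, ∀ K : MultiIndex n, N ≤ K 0 → pd (Sum.inr K) (f i) = 0 := by
  choose N hN using fun i => exists_tOrder (f i)
  exact ⟨s.sup N, fun i hi K hK => hN i K ((Finset.le_sup hi).trans hK)⟩

/-! ### The algebra of operators: action, composition, adjoint, prolongation -/

namespace LDO

theorem app_zero_left (f : DiffFun Ω) : (0 : LDO Ω).app f = 0 := Finsupp.sum_zero_index

theorem app_add_left (V W : LDO Ω) (f : DiffFun Ω) : (V + W).app f = V.app f + W.app f :=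
  Finsupp.sum_add_index' (fun _ => zero_mul _) fun _ _ _ => add_mul _ _ _

theorem app_single (J : MultiIndex n) (a f : DiffFun Ω) :
    app (Finsupp.single J a) f = a * multiD J f :=
  Finsupp.sum_single_index (zero_mul _)

theorem app_add_right (W : LDO Ω) (f g : DiffFun Ω) : W.app (f + g) = W.app f + W.app g := by
  simp only [app, multiD_add, mul_add]
  exact Finsupp.sum_add

/-- `W ↦ W(f)` as an additive map. -/
def appHomLeft (f : DiffFun Ω) : LDO Ω →+ DiffFun Ω :=
  AddMonoidHom.mk' (fun W => W.app f) fun V W => app_add_left V W f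

/-- `f ↦ W(f)` as an additive map. -/
def appHomRight (W : LDO Ω) : DiffFun Ω →+ DiffFun Ω := AddMonoidHom.mk' W.app (app_add_right W)

theorem app_neg_left (W : LDO Ω) (f : DiffFun Ω) : (-W).app f = -W.app f :=
  map_neg (appHomLeft f) W

theorem app_sub_left (V W : LDO Ω) (f : DiffFun Ω) : (V - W).app f = V.app f - W.app f :=
  map_sub (appHomLeft f) V W

theorem app_zsmul_left (m : ℤ) (W : LDO Ω) (f : DiffFun Ω) : (m • W).app f = m • W.app f :=
  map_zsmul (appHomLeft f) m W

theorem app_sum_left {ι : Type*} (s : Finset ι) (W : ι → LDO Ω) (f : DiffFun Ω) :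
    (∑ i ∈ s, W i).app f = ∑ i ∈ s, (W i).app f := map_sum (appHomLeft f) W s

theorem app_neg_right (W : LDO Ω) (f : DiffFun Ω) : W.app (-f) = -W.app f :=
  map_neg (appHomRight W) f

theorem app_sub_right (W : LDO Ω) (f g : DiffFun Ω) : W.app (f - g) = W.app f - W.app g :=
  map_sub (appHomRight W) f g

theorem app_smul_left (a : DiffFun Ω) (W : LDO Ω) (f : DiffFun Ω) :
    (a • W).app f = a * W.app f := by
  induction W using Finsupp.induction_linear with
  | zero => rw [smul_zero, app_zero_left, mul_zero]
  | add V W hV hW => rw [smul_add, app_add_left, hV, hW, app_add_left, mul_add]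
  | single J b => rw [Finsupp.smul_single, smul_eq_mul, app_single, app_single, mul_assoc]

/-- Test functions `u_K` with `K` purely in `t` suffice: beyond the `t`-order `N` of all
coefficients, `W(u_K)` is linear in the variables `u_{K+J}`, on which the coefficients do not
depend, so partial derivatives read off each `W J`. -/
theorem eq_zero_of_app_eq_zero {W : LDO Ω} (h : ∀ f, W.app f = 0) : W = 0 := by
  obtain ⟨N, hN⟩ := exists_tOrder_finset W.support W
  ext1 J
  rw [Finsupp.zero_apply]
  by_contra hJ
  have hJ' : J ∈ W.support := Finsupp.mem_support_iff.2 hJ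
  have h1 := congrArg (pd (Sum.inr (Finsupp.single 0 N + J))) (h (u (Finsupp.single 0 N)))
  rw [pd_zero, app, Finsupp.sum, pd_sum, Finset.sum_eq_single J] at h1
  · refine hJ ?_
    rw [pd_mul, multiD_u, pd_u, if_pos rfl, hN J hJ' _ (by simp), mul_zero, add_zero, mul_one] at h1
    exact h1
  · intro K hK hKJ
    rw [pd_mul, multiD_u, pd_u, if_neg fun h => hKJ (add_left_cancel h).symm,
      hN K hK _ (by simp), mul_zero, mul_zero, add_zero]
  · exact fun h => absurd hJ' h

/-- An operator is determined by its action on differential functions. -/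
theorem ext_app {V W : LDO Ω} (h : ∀ f, V.app f = W.app f) : V = W :=
  sub_eq_zero.1 (eq_zero_of_app_eq_zero fun f => by rw [app_sub_left, h, sub_self])

theorem totalDComp_add (i : Fin (n + 1)) (V W : LDO Ω) :
    totalDComp i (V + W) = totalDComp i V + totalDComp i W := by
  refine Finsupp.sum_add_index' (fun J => ?_) fun J a b => ?_
  · have : totalD i (0 : DiffFun Ω) = 0 := by rw [← multiD_single, multiD_zero]
    simp [this]
  · rw [totalD_add, Finsupp.single_add, Finsupp.single_add]
    abel

theorem totalDComp_single (i : Fin (n + 1)) (J : MultiIndex n) (a : DiffFun Ω) :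
    totalDComp i (Finsupp.single J a)
      = Finsupp.single J (totalD i a) + Finsupp.single (J + Finsupp.single i 1) a := by
  refine Finsupp.sum_single_index ?_
  have : totalD i (0 : DiffFun Ω) = 0 := by rw [← multiD_single, multiD_zero]
  simp [this]

theorem app_totalDComp (i : Fin (n + 1)) (W : LDO Ω) (f : DiffFun Ω) :
    (totalDComp i W).app f = totalD i (W.app f) := by
  induction W using Finsupp.induction_linear with
  | zero => rw [totalDComp, Finsupp.sum_zero_index, app_zero_left, ← multiD_single, multiD_zero]
  | add V W hV hW => rw [totalDComp_add, app_add_left, hV, hW, app_add_left, totalD_add]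
  | single J a =>
    rw [totalDComp_single, app_add_left, app_single, app_single, app_single, totalD_mul,
      multiD_add_single, add_comm, mul_comm (totalD i a)]

theorem app_multiDComp (K : MultiIndex n) (W : LDO Ω) (f : DiffFun Ω) :
    (multiDComp K W).app f = multiD K (W.app f) :=
  iterOver_semiconj (φ := fun W : LDO Ω => W.app f) (fun i W => app_totalDComp i W f) K W

theorem multiDComp_add (K : MultiIndex n) (V W : LDO Ω) :
    multiDComp K (V + W) = multiDComp K V + multiDComp K W :=
  ext_app fun f => by simp only [app_multiDComp, app_add_left, multiD_add]

theorem multiDComp_zero (K : MultiIndex n) : multiDComp K (0 : LDO Ω) = 0 :=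
  ext_app fun f => by simp only [app_multiDComp, app_zero_left, multiD_zero]

theorem app_comp (V W : LDO Ω) (f : DiffFun Ω) : (V.comp W).app f = V.app (W.app f) := by
  rw [comp, Finsupp.sum, app_sum_left]
  simp only [app_smul_left, app_multiDComp]
  rfl

theorem comp_sub (V W W' : LDO Ω) : V.comp (W - W') = V.comp W - V.comp W' :=
  ext_app fun f => by simp only [app_comp, app_sub_left, app_sub_right]

theorem sub_comp (V V' W : LDO Ω) : (V - V').comp W = V.comp W - V'.comp W :=
  ext_app fun f => by simp only [app_comp, app_sub_left]

theorem adjoint_add (V W : LDO Ω) : (V + W).adjoint = V.adjoint + W.adjoint := by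
  refine Finsupp.sum_add_index' (fun J => ?_) fun J a b => ?_
  · rw [Finsupp.single_zero, multiDComp_zero, smul_zero]
  · rw [Finsupp.single_add, multiDComp_add, smul_add]

/-- The formal adjoint as an additive map. -/
def adjointHom : LDO Ω →+ LDO Ω := AddMonoidHom.mk' adjoint adjoint_add

theorem adjoint_zero : (0 : LDO Ω).adjoint = 0 := map_zero adjointHom

theorem adjoint_neg (W : LDO Ω) : (-W).adjoint = -W.adjoint := map_neg adjointHom W

theorem adjoint_sub (V W : LDO Ω) : (V - W).adjoint = V.adjoint - W.adjoint :=
  map_sub adjointHom V W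

theorem adjoint_sum {ι : Type*} (s : Finset ι) (W : ι → LDO Ω) :
    (∑ i ∈ s, W i).adjoint = ∑ i ∈ s, (W i).adjoint := map_sum adjointHom W s

theorem adjoint_zsmul (m : ℤ) (W : LDO Ω) : (m • W).adjoint = m • W.adjoint :=
  map_zsmul adjointHom m W

theorem adjoint_single (J : MultiIndex n) (a : DiffFun Ω) :
    adjoint (Finsupp.single J a)
      = (-1 : ℤ) ^ J.degree • multiDComp J (Finsupp.single 0 a) :=
  Finsupp.sum_single_index (by rw [Finsupp.single_zero, multiDComp_zero, smul_zero])

theorem app_adjoint_single (J : MultiIndex n) (a f : DiffFun Ω) :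
    (adjoint (Finsupp.single J a)).app f = (-1 : ℤ) ^ J.degree • multiD J (a * f) := by
  rw [adjoint_single, app_zsmul_left, app_multiDComp, app_single, multiD_zero_index]

theorem app_adjoint (W : LDO Ω) (f : DiffFun Ω) :
    W.adjoint.app f = W.sum fun J a => (-1 : ℤ) ^ J.degree • multiD J (a * f) := by
  rw [adjoint, Finsupp.sum, app_sum_left]
  simp only [← adjoint_single, app_adjoint_single]
  rfl

theorem app_adjoint_smul (a : DiffFun Ω) (W : LDO Ω) (f : DiffFun Ω) :
    (a • W).adjoint.app f = W.adjoint.app (a * f) := by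
  induction W using Finsupp.induction_linear with
  | zero => rw [smul_zero, adjoint_zero, app_zero_left, app_zero_left]
  | add V W hV hW => rw [smul_add, adjoint_add, app_add_left, hV, hW, adjoint_add, app_add_left]
  | single J b =>
    rw [Finsupp.smul_single, smul_eq_mul, app_adjoint_single, app_adjoint_single, mul_left_comm,
      mul_assoc]

/-- On a single term, the Leibniz expansion of `D_i (a f)` cancels the contribution of `D_i a` and
leaves `a D_i f` with the opposite sign. -/
theorem app_adjoint_totalDComp (i : Fin (n + 1)) (W : LDO Ω) (f : DiffFun Ω) :
    (totalDComp i W).adjoint.app f = -W.adjoint.app (totalD i f) := by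
  induction W using Finsupp.induction_linear with
  | zero => rw [totalDComp, Finsupp.sum_zero_index, adjoint_zero, app_zero_left, app_zero_left,
      neg_zero]
  | add V W hV hW => rw [totalDComp_add, adjoint_add, app_add_left, hV, hW, adjoint_add,
      app_add_left, neg_add]
  | single J a =>
    rw [totalDComp_single, adjoint_add, app_add_left, app_adjoint_single, app_adjoint_single,
      app_adjoint_single, multiD_add_single, ← multiD_totalD, totalD_mul, multiD_add, map_add,
      Finsupp.degree_single, pow_succ, mul_comm f]
    simp only [mul_neg, mul_one, neg_smul, smul_add]
    abel

theorem app_adjoint_multiDComp (K : MultiIndex n) (W : LDO Ω) (f : DiffFun Ω) :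
    (multiDComp K W).adjoint.app f = (-1 : ℤ) ^ K.degree • W.adjoint.app (multiD K f) := by
  induction K using MultiIndex.induction generalizing f with
  | h0 =>
    rw [multiDComp, iterOver_zero, multiD_zero_index, map_zero, pow_zero, one_smul]
  | h K i ih =>
    have h1 : multiDComp (K + Finsupp.single i 1) W = totalDComp i (multiDComp K W) :=
      ext_app fun f => by
        rw [app_multiDComp, multiD_add_single, app_totalDComp, app_multiDComp]
    rw [h1, app_adjoint_totalDComp, ih, multiD_totalD, multiD_add_single, map_add,
      Finsupp.degree_single, pow_succ, mul_neg, mul_one, neg_smul]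

theorem adjoint_comp (V W : LDO Ω) : (V.comp W).adjoint = W.adjoint.comp V.adjoint := by
  refine ext_app fun f => ?_
  rw [app_comp, comp, Finsupp.sum, adjoint_sum, app_sum_left, app_adjoint V, Finsupp.sum]
  rw [show W.adjoint.app = appHomRight W.adjoint from rfl, map_sum]
  refine Finset.sum_congr rfl fun J _ => ?_
  rw [app_adjoint_smul, app_adjoint_multiDComp, map_zsmul]
  rfl

theorem adjoint_adjoint (W : LDO Ω) : W.adjoint.adjoint = W := by
  induction W using Finsupp.induction_linear with
  | zero => rw [adjoint_zero, adjoint_zero]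
  | add V W hV hW => rw [adjoint_add, adjoint_add, hV, hW]
  | single J a =>
    refine ext_app fun f => ?_
    rw [adjoint_single, adjoint_zsmul, app_zsmul_left, app_adjoint_multiDComp, smul_smul,
      ← mul_pow, neg_mul_neg, one_mul, one_pow, one_smul, app_adjoint_single, map_zero, pow_zero,
      one_smul, multiD_zero_index, app_single]

theorem prX_add (P : DiffFun Ω) (V W : LDO Ω) : (V + W).prX P = V.prX P + W.prX P :=
  Finsupp.sum_add_index' (fun J => by rw [prX_zero, Finsupp.single_zero])
    fun J a b => by rw [EvolutionJet.prX_add, Finsupp.single_add]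

theorem prX_single (P : DiffFun Ω) (J : MultiIndex n) (a : DiffFun Ω) :
    LDO.prX P (Finsupp.single J a) = Finsupp.single J (EvolutionJet.prX P a) :=
  Finsupp.sum_single_index (by rw [prX_zero, Finsupp.single_zero])

/-- `pr X_P` on the coefficients of operators as an additive map. -/
def prXHom (P : DiffFun Ω) : LDO Ω →+ LDO Ω := AddMonoidHom.mk' (LDO.prX P) (prX_add P)

theorem prX_sub (P : DiffFun Ω) (V W : LDO Ω) : (V - W).prX P = V.prX P - W.prX P :=
  map_sub (prXHom P) V W

theorem prX_apply (P : DiffFun Ω) (W : LDO Ω) (J : MultiIndex n) :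
    W.prX P J = EvolutionJet.prX P (W J) := by
  induction W using Finsupp.induction_linear with
  | zero => rw [LDO.prX, Finsupp.sum_zero_index, Finsupp.zero_apply, prX_zero]
  | add V W hV hW =>
    rw [prX_add, Finsupp.add_apply, hV, hW, Finsupp.add_apply, EvolutionJet.prX_add]
  | single K a =>
    rw [prX_single]
    by_cases h : K = J
    · subst h
      rw [Finsupp.single_eq_same, Finsupp.single_eq_same]
    · rw [Finsupp.single_eq_of_ne' h, Finsupp.single_eq_of_ne' h, prX_zero]

/-- `pr X_P` acts on operators as the commutator with `pr X_P`. -/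
theorem prX_app (P : DiffFun Ω) (W : LDO Ω) (f : DiffFun Ω) :
    EvolutionJet.prX P (W.app f) = (W.prX P).app f + W.app (EvolutionJet.prX P f) := by
  induction W using Finsupp.induction_linear with
  | zero => rw [LDO.prX, Finsupp.sum_zero_index, app_zero_left, app_zero_left, prX_zero, add_zero]
  | add V W hV hW =>
    rw [prX_add, app_add_left, EvolutionJet.prX_add, hV, hW, app_add_left, app_add_left]
    abel
  | single J a =>
    rw [prX_single, app_single, app_single, app_single, prX_mul, prX_multiD]
    ring

theorem prX_adjoint (P : DiffFun Ω) (W : LDO Ω) : W.adjoint.prX P = (W.prX P).adjoint := by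
  induction W using Finsupp.induction_linear with
  | zero => simp only [LDO.prX, adjoint, Finsupp.sum_zero_index]
  | add V W hV hW => rw [adjoint_add, prX_add, hV, hW, prX_add, adjoint_add]
  | single J a =>
    refine ext_app fun f => ?_
    have h := prX_app P (adjoint (Finsupp.single J a)) f
    rw [app_adjoint_single, app_adjoint_single, prX_zsmul, prX_multiD, prX_mul] at h
    rw [prX_single, app_adjoint_single, ← sub_eq_iff_eq_add.2 h, multiD_add, zsmul_add,
      add_sub_cancel_left, mul_comm f]

/-! ### Linearization of operators and symmetry of second derivatives -/

/-- The operator `V ↦ (pr X_V W)(P)`. -/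
def lin (W : LDO Ω) (P : DiffFun Ω) : LDO Ω := W.sum fun J a => multiD J P • frechet a

end LDO

theorem app_frechet (f V : DiffFun Ω) : (frechet f).app V = prX V f := by
  simp only [LDO.app, prX, mul_comm]

theorem frechet_neg (f : DiffFun Ω) : frechet (-f) = -frechet f :=
  LDO.ext_app fun V => by simp only [app_frechet, prX_neg, LDO.app_neg_left]

theorem frechet_sub (f f' : DiffFun Ω) : frechet (f - f') = frechet f - frechet f' :=
  LDO.ext_app fun V => by simp only [app_frechet, prX_sub, LDO.app_sub_left]

theorem frechet_mul (f f' : DiffFun Ω) : frechet (f * f') = f • frechet f' + f' • frechet f :=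
  LDO.ext_app fun V => by
    simp only [app_frechet, prX_mul, LDO.app_add_left, LDO.app_smul_left]

namespace LDO

theorem app_lin (W : LDO Ω) (P V : DiffFun Ω) : (W.lin P).app V = (W.prX V).app P := by
  rw [lin, Finsupp.sum, app_sum_left, LDO.prX, Finsupp.sum, app_sum_left]
  refine Finset.sum_congr rfl fun J _ => ?_
  rw [app_smul_left, app_frechet, app_single, mul_comm]

theorem lin_sub (V W : LDO Ω) (P : DiffFun Ω) : (V - W).lin P = V.lin P - W.lin P :=
  ext_app fun f => by simp only [app_lin, prX_sub, app_sub_left]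

theorem frechet_app (W : LDO Ω) (P : DiffFun Ω) :
    frechet (W.app P) = W.lin P + W.comp (frechet P) :=
  ext_app fun V => by
    rw [app_frechet, prX_app, app_add_left, app_lin, app_comp, app_frechet]

/-- Second Frechet derivatives are symmetric. -/
theorem lin_frechet (f P : DiffFun Ω) : (frechet f).lin P = (frechet f).prX P := by
  ext1 K
  rw [prX_apply, lin, Finsupp.sum, Finsupp.finsetSum_apply, frechet_apply,
    prX_eq_vectorField, vectorField_eq_frechet_sum _ _ fun i => rfl]
  rw [Finsupp.sum_of_support_subset (s := (frechet f).support)]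
  · refine Finset.sum_congr rfl fun J _ => ?_
    simp only [Finsupp.smul_apply, frechet_apply, smul_eq_mul, prXField]
    rw [pd_comm]
  · intro J hJ
    rw [Finsupp.mem_support_iff] at hJ ⊢
    intro h
    rw [frechet_apply] at h hJ
    rw [pd_comm, h, pd_zero] at hJ
    exact hJ rfl
  · exact fun J _ => mul_zero _

/-- As a double sum weighted by the Hessian of `f`, the operator is visibly self-adjoint: taking
adjoints exchanges `J` and `K`. -/
theorem adjoint_frechet_lin_eq_sum (f P : DiffFun Ω) : (frechet f).adjoint.lin P
    = ∑ J ∈ (frechet f).support, ∑ K ∈ (frechet f).support, (-1 : ℤ) ^ J.degree •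
      multiDComp J (Finsupp.single K (P * pd (Sum.inr K) (pd (Sum.inr J) f))) := by
  refine ext_app fun V => ?_
  rw [app_lin, prX_adjoint, app_adjoint, Finsupp.sum_of_support_subset (s := (frechet f).support),
    app_sum_left]
  · refine Finset.sum_congr rfl fun J _ => ?_
    rw [app_sum_left, prX_apply, frechet_apply, EvolutionJet.prX,
      Finsupp.sum_of_support_subset (s := (frechet f).support), Finset.sum_mul, multiD_sum,
      Finset.smul_sum]
    · refine Finset.sum_congr rfl fun K _ => ?_
      rw [app_zsmul_left, app_multiDComp, app_single, frechet_apply]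
      congr 2
      ring
    · intro K hK
      rw [Finsupp.mem_support_iff] at hK ⊢
      intro h
      rw [frechet_apply] at h hK
      rw [pd_comm, h, pd_zero] at hK
      exact hK rfl
    · exact fun K _ => mul_zero _
  · intro J hJ
    rw [Finsupp.mem_support_iff] at hJ ⊢
    intro h
    rw [prX_apply, h, prX_zero] at hJ
    exact hJ rfl
  · intro J _
    rw [zero_mul, multiD_zero, smul_zero]

/-- The operator `V ↦ (pr X_V f'*)(P)` is self-adjoint. -/
theorem adjoint_adjoint_frechet_lin (f P : DiffFun Ω) :
    ((frechet f).adjoint.lin P).adjoint = (frechet f).adjoint.lin P := by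
  rw [adjoint_frechet_lin_eq_sum, adjoint_sum]
  simp only [adjoint_sum]
  rw [Finset.sum_comm]
  -- In the adjoint of a term the two signs from its outer derivative cancel, and its inner
  -- derivative supplies the sign of the transposed term.
  refine Finset.sum_congr rfl fun J _ => Finset.sum_congr rfl fun K _ => ext_app fun V => ?_
  rw [adjoint_zsmul, app_zsmul_left, app_adjoint_multiDComp, smul_smul, ← mul_pow, neg_mul_neg,
    one_mul, one_pow, one_smul, app_adjoint_single, app_zsmul_left, app_multiDComp, app_single,
    pd_comm]

end LDO

/-! ### The Euler-Lagrange operator through adjoints -/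

theorem euler_eq (f : DiffFun Ω) : euler f = (frechet f).adjoint.app 1 := by
  rw [LDO.app_adjoint]
  simp only [euler, mul_one]

/-- `E_u(fg) = f'*(g) + g'*(f)`. -/
theorem euler_mul (f g : DiffFun Ω) :
    euler (f * g) = (frechet g).adjoint.app f + (frechet f).adjoint.app g := by
  rw [euler_eq, frechet_mul, LDO.adjoint_add, LDO.app_add_left, LDO.app_adjoint_smul,
    LDO.app_adjoint_smul, mul_one, mul_one]

/-! ### Functions and operators without `t`-derivatives -/

section TFree

theorem IsTFree.add {f f' : DiffFun Ω} (hf : IsTFree f) (hf' : IsTFree f') : IsTFree (f + f') :=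
  fun z w h => by rw [eval_add, eval_add, hf z w h, hf' z w h]

theorem IsTFree.mul {f f' : DiffFun Ω} (hf : IsTFree f) (hf' : IsTFree f') : IsTFree (f * f') :=
  fun z w h => by rw [eval_mul, eval_mul, hf z w h, hf' z w h]

theorem IsTFree.neg {f : DiffFun Ω} (hf : IsTFree f) : IsTFree (-f) :=
  fun z w h => by rw [eval_neg, eval_neg, hf z w h]

theorem isTFree_zero : IsTFree (0 : DiffFun Ω) := fun _ _ _ => rfl

theorem isTFree_u {K : MultiIndex n} (hK : K 0 = 0) : IsTFree (u K : DiffFun Ω) :=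
  fun _ _ h => h (Sum.inr K) hK

theorem isTFree_sum {ι : Type*} {s : Finset ι} {f : ι → DiffFun Ω} (h : ∀ i ∈ s, IsTFree (f i)) :
    IsTFree (∑ i ∈ s, f i) :=
  Finset.sum_induction f IsTFree (fun _ _ => IsTFree.add) isTFree_zero h

variable (hΩ : IsSpatialDomain Ω)
include hΩ

/-- Since `Ω` is a spatial domain, the whole coordinate line in direction `c` stays in `Ω`, and `f`
is constant on it. -/
theorem IsTFree.pd_eq_zero {f : DiffFun Ω} (hf : IsTFree f) {c : JetCoord n}
    (hc : ¬IsSpatialCoord c) : pd c f = 0 := by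
  refine DiffFun.ext fun z => (hasDerivAt_pd c f z).unique ?_
  refine (hasDerivAt_const (z.1 c) (eval f z)).congr_of_eventuallyEq
    (Filter.Eventually.of_forall fun r => ?_)
  have h : ∀ b, IsSpatialCoord b → Function.update z.1 c r b = z.1 b := fun b hb =>
    Function.update_of_ne (by rintro rfl; exact hc hb) _ _
  have hr := hΩ z z.2 _ h
  exact (Subtype.val_injective.extend_apply f.1 (0 : Jet n → ℝ) ⟨_, hr⟩).trans (hf ⟨_, hr⟩ z h)

theorem IsTFree.pd {f : DiffFun Ω} (hf : IsTFree f) (c : JetCoord n) : IsTFree (pd c f) := by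
  by_cases hc : IsSpatialCoord c
  · intro z w h
    refine (hasDerivAt_pd c f z).unique ?_
    rw [h c hc]
    refine (hasDerivAt_pd c f w).congr_of_eventuallyEq ?_
    filter_upwards [eventually_update_mem c w] with r hr
    have h1 : ∀ b, IsSpatialCoord b → Function.update z.1 c r b = Function.update w.1 c r b := by
      intro b hb
      by_cases hbc : b = c
      · subst hbc
        rw [Function.update_self, Function.update_self]
      · rw [Function.update_of_ne hbc, Function.update_of_ne hbc, h b hb]
    have hr' := hΩ _ hr _ h1
    exact ((Subtype.val_injective.extend_apply f.1 (0 : Jet n → ℝ) ⟨_, hr'⟩).trans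
      (hf ⟨_, hr'⟩ ⟨_, hr⟩ h1)).trans
      (Subtype.val_injective.extend_apply f.1 (0 : Jet n → ℝ) ⟨_, hr⟩).symm
  · rw [hf.pd_eq_zero hΩ hc]
    exact isTFree_zero

theorem IsTFree.frechet_eq_zero {f : DiffFun Ω} (hf : IsTFree f) {K : MultiIndex n}
    (hK : K 0 ≠ 0) : frechet f K = 0 := hf.pd_eq_zero hΩ (c := Sum.inr K) hK

theorem IsTFree.totalD {f : DiffFun Ω} (hf : IsTFree f) {i : Fin (n + 1)} (hi : i ≠ 0) :
    IsTFree (totalD i f) := by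
  refine (hf.pd hΩ _).add (isTFree_sum fun K hK => (isTFree_u ?_).mul (hf.pd hΩ _))
  have hK0 : K 0 = 0 := by
    by_contra h
    exact Finsupp.mem_support_iff.1 hK (hf.frechet_eq_zero hΩ h)
  simp [hK0, hi]

theorem IsTFree.multiD {f : DiffFun Ω} (hf : IsTFree f) {K : MultiIndex n} (hK : K 0 = 0) :
    IsTFree (multiD K f) :=
  iterOver_induction K hf fun _ _ hi hb => hb.totalD hΩ fun h => hi (h ▸ hK)

theorem IsTFree.prX {P f : DiffFun Ω} (hP : IsTFree P) (hf : IsTFree f) : IsTFree (prX P f) := by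
  refine isTFree_sum fun K hK => (hP.multiD hΩ ?_).mul (hf.pd hΩ _)
  by_contra h
  exact Finsupp.mem_support_iff.1 hK (hf.frechet_eq_zero hΩ h)

end TFree

namespace LDO

/-- The operators in spatial total derivatives whose coefficients contain no `t`-derivatives
of `u`. -/
def IsSpatial (W : LDO Ω) : Prop := ∀ J, IsTFree (W J) ∧ (J 0 ≠ 0 → W J = 0)

theorem isSpatial_zero : IsSpatial (0 : LDO Ω) := fun _ => ⟨isTFree_zero, fun _ => rfl⟩

theorem IsSpatial.add {V W : LDO Ω} (hV : V.IsSpatial) (hW : W.IsSpatial) : (V + W).IsSpatial :=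
  fun J => ⟨(hV J).1.add (hW J).1, fun hJ => by
    rw [Finsupp.add_apply, (hV J).2 hJ, (hW J).2 hJ, add_zero]⟩

theorem IsSpatial.neg {W : LDO Ω} (hW : W.IsSpatial) : (-W).IsSpatial :=
  fun J => ⟨(hW J).1.neg, fun hJ => by rw [Finsupp.neg_apply, (hW J).2 hJ, neg_zero]⟩

theorem IsSpatial.sub {V W : LDO Ω} (hV : V.IsSpatial) (hW : W.IsSpatial) : (V - W).IsSpatial := by
  have h : V - W = V + -W := sub_eq_add_neg V W
  rw [h]
  exact hV.add hW.neg

theorem isSpatial_sum {ι : Type*} {s : Finset ι} {W : ι → LDO Ω} (h : ∀ i ∈ s, (W i).IsSpatial) :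
    (∑ i ∈ s, W i).IsSpatial :=
  Finset.sum_induction W IsSpatial (fun _ _ => IsSpatial.add) isSpatial_zero h

theorem isSpatial_single {J : MultiIndex n} (hJ : J 0 = 0) {a : DiffFun Ω} (ha : IsTFree a) :
    IsSpatial (Finsupp.single J a) := by
  intro K
  by_cases h : J = K
  · subst h
    rw [Finsupp.single_eq_same]
    exact ⟨ha, fun h => absurd hJ h⟩
  · rw [Finsupp.single_eq_of_ne' h]
    exact ⟨isTFree_zero, fun _ => rfl⟩

theorem IsSpatial.eq_zero_of_mem_support {W : LDO Ω} (hW : W.IsSpatial) {J : MultiIndex n}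
    (hJ : J ∈ W.support) : J 0 = 0 := by
  by_contra h
  exact Finsupp.mem_support_iff.1 hJ ((hW J).2 h)

variable (hΩ : IsSpatialDomain Ω)
include hΩ

theorem isSpatial_frechet {f : DiffFun Ω} (hf : IsTFree f) : (frechet f).IsSpatial :=
  fun _ => ⟨hf.pd hΩ _, hf.frechet_eq_zero hΩ⟩

theorem IsSpatial.totalDComp {W : LDO Ω} (hW : W.IsSpatial) {i : Fin (n + 1)} (hi : i ≠ 0) :
    (totalDComp i W).IsSpatial := by
  refine isSpatial_sum fun J hJ => ?_
  have hJ0 := hW.eq_zero_of_mem_support hJ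
  exact (isSpatial_single hJ0 ((hW J).1.totalD hΩ hi)).add
    (isSpatial_single (by simp [hJ0, hi]) (hW J).1)

theorem IsSpatial.multiDComp {W : LDO Ω} (hW : W.IsSpatial) {K : MultiIndex n} (hK : K 0 = 0) :
    (multiDComp K W).IsSpatial :=
  iterOver_induction K hW fun _ _ hi hV => hV.totalDComp hΩ fun h => hi (h ▸ hK)

theorem IsSpatial.adjoint {W : LDO Ω} (hW : W.IsSpatial) : W.adjoint.IsSpatial := by
  refine isSpatial_sum fun J hJ => ?_
  have h := (isSpatial_single (J := 0) rfl (hW J).1).multiDComp hΩ (hW.eq_zero_of_mem_support hJ)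
  rcases neg_one_pow_eq_or ℤ J.degree with h1 | h1 <;> simp only [h1]
  · rwa [one_smul]
  · have h2 : (-1 : ℤ) • LDO.multiDComp J (Finsupp.single 0 (W J))
        = -LDO.multiDComp J (Finsupp.single 0 (W J)) :=
      neg_one_zsmul (LDO.multiDComp J (Finsupp.single 0 (W J)))
    rw [h2]
    exact h.neg

theorem IsSpatial.app {W : LDO Ω} (hW : W.IsSpatial) {f : DiffFun Ω} (hf : IsTFree f) :
    IsTFree (W.app f) :=
  isTFree_sum fun J hJ => (hW J).1.mul (hf.multiD hΩ (hW.eq_zero_of_mem_support hJ))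

end LDO

/-! ### Growth of the order in `t` -/

section TOrder

/-- By `pd_totalD`, the only new variables in `D_i f` are `u_{K+i}` with `u_K` occurring in `f`, so
the order in `t` grows only for `i = 0`, and then by one. -/
theorem pd_totalD_eq_zero {f : DiffFun Ω} {m : ℕ}
    (hf : ∀ L : MultiIndex n, m < L 0 → pd (Sum.inr L) f = 0) (i : Fin (n + 1))
    {L : MultiIndex n} (hL : m + (Finsupp.single i 1 : MultiIndex n) 0 < L 0) :
    pd (Sum.inr L) (totalD i f) = 0 := by
  have hz : totalD i (0 : DiffFun Ω) = 0 := by rw [← multiD_single, multiD_zero]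
  rw [pd_totalD, hf L (by omega), hz, zero_add]
  obtain ⟨s, hs⟩ := exists_finset_pd_eq_zero f
  rw [vectorField_eq_sum _ hs]
  refine Finset.sum_eq_zero fun c _ => ?_
  rcases c with j | K
  · simp only [totalDField, pd_single_one, zero_mul]
  · simp only [totalDField, pd_u]
    by_cases h : L = K + Finsupp.single i 1
    · have h0 : L 0 = K 0 + (Finsupp.single i 1 : MultiIndex n) 0 := by rw [h, Finsupp.add_apply]
      rw [hf K (by omega), mul_zero]
    · rw [if_neg h, zero_mul]

theorem pd_multiD_eq_zero {f : DiffFun Ω} {m : ℕ}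
    (hf : ∀ L : MultiIndex n, m < L 0 → pd (Sum.inr L) f = 0) (K : MultiIndex n) :
    ∀ L : MultiIndex n, m + K 0 < L 0 → pd (Sum.inr L) (multiD K f) = 0 := by
  induction K using MultiIndex.induction with
  | h0 =>
    intro L hL
    rw [multiD_zero_index]
    exact hf L (by simpa using hL)
  | h K i ih =>
    intro L hL
    rw [multiD_add_single]
    exact pd_totalD_eq_zero ih i (by rw [Finsupp.add_apply] at hL; omega)

end TOrder

/-! ### The solution space of `u_t = g` and the retraction onto it -/

section Evolution

theorem multiD_evolutionPDE (g : DiffFun Ω) (K : MultiIndex n) :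
    multiD K (evolutionPDE g) = u (K + Finsupp.single 0 1) - multiD K g := by
  rw [evolutionPDE, multiD_sub, multiD_u, add_comm]

/-- The components of the total time derivative along the flow of `u_t = g`. -/
def evolField (g : DiffFun Ω) : JetCoord n → DiffFun Ω
  | Sum.inl j => (Pi.single 0 1 : Fin (n + 1) → DiffFun Ω) j
  | Sum.inr K => multiD K g

/-- The total time derivative along the flow of `u_t = g`. -/
def evolD (g f : DiffFun Ω) : DiffFun Ω := vectorField (evolField g) f

theorem evolD_eq (g f : DiffFun Ω) : evolD g f = pd (Sum.inl 0) f + prX g f := by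
  have h : evolField g = fun c =>
      (Pi.single (Sum.inl 0) 1 : JetCoord n → DiffFun Ω) c + prXField g c := by
    funext c
    rcases c with j | K
    · by_cases hj : j = 0
      · subst hj
        simp [evolField, prXField]
      · simp [evolField, prXField, hj]
    · simp [evolField, prXField]
  rw [evolD, h, vectorField_add_left, vectorField_single, prX_eq_vectorField]

/-- Since `D_K G = u_{K,t} - D_K g`, the two vector fields add up to `D_t` component by component.
The second term is `f'(G)`, an operator applied to `G`. -/
theorem totalD_zero_eq (g f : DiffFun Ω) : totalD 0 f = evolD g f + prX (evolutionPDE g) f := by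
  rw [totalD_eq_vectorField, evolD, prX_eq_vectorField, ← vectorField_add_left]
  congr 1
  funext c
  rcases c with j | K
  · simp only [totalDField, evolField, prXField, add_zero]
  · simp only [totalDField, evolField, prXField, multiD_evolutionPDE, add_sub_cancel]

theorem totalD_evolD (g : DiffFun Ω) (i : Fin (n + 1)) (f : DiffFun Ω) :
    totalD i (evolD g f) = evolD g (totalD i f) := by
  simp only [evolD, totalD_eq_vectorField]
  refine vectorField_commute (fun c => ?_) f
  simp only [← totalD_eq_vectorField]
  rcases c with k | K
  · simp only [totalDField, evolField, totalD_eq_vectorField, vectorField_single_one]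
  · simp only [totalDField, evolField, u, vectorField_coord, multiD_add_single]

/-- The components of the retraction of `Ω` onto the space of formal solutions of `u_t = g`, which
eliminates the `t`-derivatives of `u`. -/
def solutionCoord (g : DiffFun Ω) : JetCoord n → DiffFun Ω
  | Sum.inl i => coord (Sum.inl i)
  | Sum.inr K => (evolD g)^[K 0] (u (K.erase 0))

theorem solutionCoord_of_spatial (g : DiffFun Ω) {c : JetCoord n} (hc : IsSpatialCoord c) :
    solutionCoord g c = coord c := by
  rcases c with i | K
  · rfl
  · have hK : K 0 = 0 := hc
    simp only [solutionCoord, hK, Function.iterate_zero, id]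
    rw [Finsupp.erase_of_notMem_support (by simpa using hK)]
    rfl

theorem solutionCoord_add_zero (g : DiffFun Ω) (K : MultiIndex n) :
    solutionCoord g (Sum.inr (K + Finsupp.single 0 1)) = evolD g (solutionCoord g (Sum.inr K)) := by
  simp only [solutionCoord]
  have h0 : (K + Finsupp.single 0 1 : MultiIndex n) 0 = K 0 + 1 := by simp
  rw [Finsupp.erase_add, Finsupp.erase_single, add_zero, h0, Function.iterate_succ_apply']

theorem solutionCoord_add_ne (g : DiffFun Ω) (K : MultiIndex n) {i : Fin (n + 1)} (hi : i ≠ 0) :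
    solutionCoord g (Sum.inr (K + Finsupp.single i 1)) = totalD i (solutionCoord g (Sum.inr K)) := by
  simp only [solutionCoord]
  rw [Finsupp.erase_add, Finsupp.erase_single_ne hi.symm, ← totalD_u]
  have h0 : (K + Finsupp.single i 1 : MultiIndex n) 0 = K 0 := by simp [hi]
  rw [h0]
  exact (Function.Semiconj.iterate_right (f := totalD i) (fun a => totalD_evolD g i a) _ _).symm

theorem solutionCoord_mem (hΩ : IsSpatialDomain Ω) (g : DiffFun Ω) (z : Ω) :
    (fun c => eval (solutionCoord g c) z) ∈ Ω :=
  hΩ z z.2 _ fun c hc => by rw [solutionCoord_of_spatial g hc]; rfl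

/-- The restriction of a differential function to the space of formal solutions of `u_t = g`,
as a function of `t`, `x`, `u` and the spatial derivatives of `u`. -/
def reduce (hΩ : IsSpatialDomain Ω) (g f : DiffFun Ω) : DiffFun Ω :=
  pullback (solutionCoord g) (solutionCoord_mem hΩ g) f

variable (hΩ : IsSpatialDomain Ω)

theorem IsTFree.reduce_eq {f : DiffFun Ω} (hf : IsTFree f) (g : DiffFun Ω) : reduce hΩ g f = f :=
  DiffFun.ext fun z => hf _ _ fun c hc => by
    change eval (solutionCoord g c) z = _
    rw [solutionCoord_of_spatial g hc]
    rfl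

/-- The components of the total derivative `D_i` on the space of formal solutions. -/
def reducedField (g : DiffFun Ω) (i : Fin (n + 1)) : JetCoord n → DiffFun Ω :=
  if i = 0 then evolField g else totalDField i

/-- Total derivatives are tangent to the solution space: under the retraction they correspond to
`evolD g` for `i = 0` and to the usual `D_i` otherwise. Hence vanishing on solutions is inherited by
total derivatives. -/
theorem reduce_totalD (g : DiffFun Ω) (i : Fin (n + 1)) (f : DiffFun Ω) :
    reduce hΩ g (totalD i f) = vectorField (reducedField g i) (reduce hΩ g f) := by
  rw [totalD_eq_vectorField]
  refine (vectorField_pullback _ (solutionCoord_mem hΩ g) (fun c => ?_) f).symm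
  rcases c with j | K
  · have h : reducedField g i (Sum.inl j) = (Pi.single i 1 : Fin (n + 1) → DiffFun Ω) j := by
      unfold reducedField
      split_ifs with hi
      · subst hi
        rfl
      · rfl
    rw [solutionCoord, vectorField_coord, h, totalDField]
    by_cases hj : j = i
    · subst hj
      rw [Pi.single_eq_same]
      rfl
    · rw [Pi.single_eq_of_ne hj]
      rfl
  · rw [totalDField, u, pullback_coord, reducedField]
    split_ifs with hi
    · subst hi
      exact (solutionCoord_add_zero g K).symm
    · rw [solutionCoord_add_ne g K hi, totalD_eq_vectorField]

theorem reduce_multiD_eq_zero {g f : DiffFun Ω} (hf : reduce hΩ g f = 0) (K : MultiIndex n) :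
    reduce hΩ g (multiD K f) = 0 :=
  iterOver_induction (p := fun f => reduce hΩ g f = 0) K hf fun i b _ hb => by
    rw [reduce_totalD, hb, vectorField_zero]

theorem reduce_evolutionPDE {g : DiffFun Ω} (hg : IsTFree g) :
    reduce hΩ g (evolutionPDE g) = 0 := by
  have h1 : reduce hΩ g (evolutionPDE g)
      = solutionCoord g (Sum.inr (Finsupp.single 0 1)) - reduce hΩ g g := rfl
  have h2 := solutionCoord_add_zero g 0
  rw [zero_add, solutionCoord_of_spatial g (c := Sum.inr 0) rfl, evolD, vectorField_coord,
    evolField, multiD_zero_index] at h2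
  rw [h1, hg.reduce_eq, h2, sub_self]

/-- The functions all of whose total derivatives vanish at `z` form an ideal. -/
theorem eval_multiD_mul_eq_zero {z : Ω} (K : MultiIndex n) {a f : DiffFun Ω}
    (hf : ∀ K, eval (multiD K f) z = 0) : eval (multiD K (a * f)) z = 0 := by
  induction K using MultiIndex.induction generalizing a f with
  | h0 =>
    have h := hf 0
    rw [multiD_zero_index] at h ⊢
    rw [eval_mul, h, mul_zero]
  | h K i ih =>
    rw [multiD_add_single, ← multiD_totalD, totalD_mul, multiD_add, eval_add, mul_comm f, ih hf,
      ih fun J => ?_, add_zero]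
    rw [multiD_totalD, ← multiD_add_single]
    exact hf _

theorem eval_multiD_app_eq_zero {z : Ω} {f : DiffFun Ω} (hf : ∀ K, eval (multiD K f) z = 0)
    (W : LDO Ω) (K : MultiIndex n) : eval (multiD K (W.app f)) z = 0 := by
  have key (J : MultiIndex n) : ∀ K, eval (multiD K (multiD J f)) z = 0 := by
    induction J using MultiIndex.induction with
    | h0 => rwa [multiD_zero_index]
    | h J i ih =>
      intro K
      rw [multiD_add_single, multiD_totalD, ← multiD_add_single]
      exact ih _
  rw [LDO.app, Finsupp.sum, multiD_sum, eval_sum]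
  exact Finset.sum_eq_zero fun J _ => eval_multiD_mul_eq_zero K (key J)

/-- Induction on `J` differentiates the difference, so all its total derivatives must be carried
along. For `i = 0`, replacing `D_t` by `evolD g` costs an operator applied to `G`, which vanishes at
`z` with all its derivatives. -/
theorem eval_multiD_solutionCoord_sub {g : DiffFun Ω} {z : Ω}
    (hz : ∀ K, eval (multiD K (evolutionPDE g)) z = 0) (J : MultiIndex n) :
    ∀ K, eval (multiD K (solutionCoord g (Sum.inr J) - u J)) z = 0 := by
  induction J using MultiIndex.induction with
  | h0 =>
    intro K
    rw [solutionCoord_of_spatial g (c := Sum.inr 0) rfl, u, sub_self, multiD_zero, eval_zero]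
  | h J i ih =>
    intro K
    have h1 : eval (multiD K (totalD i (solutionCoord g (Sum.inr J) - u J))) z = 0 := by
      rw [multiD_totalD, ← multiD_add_single]
      exact ih _
    rw [totalD_sub, totalD_u] at h1
    by_cases hi : i = 0
    · subst hi
      have h2 := eval_multiD_app_eq_zero hz (frechet (solutionCoord g (Sum.inr J))) K
      rw [app_frechet] at h2
      rw [totalD_zero_eq g, add_sub_right_comm, multiD_add, eval_add, h2, add_zero] at h1
      rw [solutionCoord_add_zero]
      exact h1
    · rw [solutionCoord_add_ne g J hi]
      exact h1

/-- The map `solutionCoord g` sends `Ω` into the solution space, since `G` and its derivatives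
reduce to zero, and it fixes every solution point. -/
theorem vanishesOnSolutions_iff {g : DiffFun Ω} (hg : IsTFree g) (f : DiffFun Ω) :
    VanishesOnSolutions (evolutionPDE g) f ↔ reduce hΩ g f = 0 := by
  constructor
  · intro h
    refine DiffFun.ext fun z => h _ fun K => ?_
    have h1 := reduce_multiD_eq_zero hΩ (reduce_evolutionPDE hΩ hg) K
    exact congrArg (fun k => eval k z) h1
  · intro h z hz
    have h1 : (fun c => eval (solutionCoord g c) z) = z.1 := by
      funext c
      rcases c with i | K
      · rfl
      · have h2 := eval_multiD_solutionCoord_sub hz K 0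
        rw [multiD_zero_index, eval_sub, sub_eq_zero] at h2
        exact h2
    have h3 : eval (reduce hΩ g f) z = eval f z := congrArg (eval f) (Subtype.ext h1)
    rw [← h3, h, eval_zero]

variable {hΩ}

theorem VanishesOnSolutions.add {G f f' : DiffFun Ω} (hf : VanishesOnSolutions G f)
    (hf' : VanishesOnSolutions G f') : VanishesOnSolutions G (f + f') :=
  fun z hz => by rw [eval_add, hf z hz, hf' z hz, add_zero]

theorem VanishesOnSolutions.neg {G f : DiffFun Ω} (hf : VanishesOnSolutions G f) :
    VanishesOnSolutions G (-f) := fun z hz => by rw [eval_neg, hf z hz, neg_zero]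

theorem vanishesOnSolutions_app (W : LDO Ω) (G : DiffFun Ω) : VanishesOnSolutions G (W.app G) :=
  fun z hz => by simpa only [multiD_zero_index] using eval_multiD_app_eq_zero hz W 0

theorem VanishesOnSolutions.app (hΩ : IsSpatialDomain Ω) {g f : DiffFun Ω} (hg : IsTFree g)
    (hf : VanishesOnSolutions (evolutionPDE g) f) (W : LDO Ω) :
    VanishesOnSolutions (evolutionPDE g) (W.app f) := by
  intro z hz
  rw [LDO.app, Finsupp.sum, eval_sum]
  refine Finset.sum_eq_zero fun J _ => ?_
  have h := reduce_multiD_eq_zero hΩ ((vanishesOnSolutions_iff hΩ hg f).1 hf) J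
  rw [eval_mul, (vanishesOnSolutions_iff hΩ hg _).2 h z hz, mul_zero]

/-- Each coefficient of `pr X_G W` is `(W J)'(G)`, an operator applied to `G`. -/
theorem vanishesOnSolutions_prX_app (W : LDO Ω) (G P : DiffFun Ω) :
    VanishesOnSolutions G ((W.prX G).app P) := by
  intro z hz
  rw [LDO.app, Finsupp.sum, eval_sum]
  refine Finset.sum_eq_zero fun J _ => ?_
  rw [LDO.prX_apply, ← app_frechet, eval_mul, vanishesOnSolutions_app _ G z hz, zero_mul]

/-- A differential function without `t`-derivatives of `u` that vanishes on solutions is zero. -/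
theorem IsTFree.eq_zero_of_vanishesOnSolutions (hΩ : IsSpatialDomain Ω) {g f : DiffFun Ω}
    (hg : IsTFree g) (hf : IsTFree f) (h : VanishesOnSolutions (evolutionPDE g) f) : f = 0 := by
  rw [← hf.reduce_eq hΩ g]
  exact (vanishesOnSolutions_iff hΩ hg f).1 h

/-- An operator without `t`-derivatives of `u` in its coefficients is determined by its value on
`u_t - g`. -/
theorem LDO.eq_zero_of_app_evolutionPDE (hΩ : IsSpatialDomain Ω) {g : DiffFun Ω} (hg : IsTFree g)
    {W : LDO Ω} (hW : ∀ J, IsTFree (W J)) (h : W.app (evolutionPDE g) = 0) : W = 0 := by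
  by_contra hne
  -- Take `J` with the most `t`-derivatives. Each `D_K g` has order in `t` at most `K 0 ≤ J 0`, so
  -- `u_{J,t}` enters `W(G)` only through the leading variable of `D_J G`, with coefficient `W J`.
  obtain ⟨J, hJ, hmax⟩ := W.support.exists_max_image (fun J => J 0)
    (Finsupp.support_nonempty_iff.2 hne)
  have h1 := congrArg (pd (Sum.inr (J + Finsupp.single 0 1))) h
  have hWpd (K : MultiIndex n) : pd (Sum.inr (J + Finsupp.single 0 1)) (W K) = 0 :=
    (hW K).frechet_eq_zero hΩ (by simp)
  have hgpd (K) (hK : K ∈ W.support) :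
      pd (Sum.inr (J + Finsupp.single 0 1)) (EvolutionJet.multiD K g) = 0 := by
    refine pd_multiD_eq_zero (m := 0) (fun L hL => hg.frechet_eq_zero hΩ hL.ne') K _ ?_
    have := hmax K hK
    simp only [Finsupp.add_apply, Finsupp.single_eq_same]
    omega
  rw [pd_zero, LDO.app, Finsupp.sum, pd_sum, Finset.sum_eq_single J] at h1
  · rw [pd_mul, multiD_evolutionPDE, pd_sub, pd_u, if_pos rfl, hgpd J hJ, hWpd, mul_zero,
      add_zero, sub_zero, mul_one] at h1
    exact Finsupp.mem_support_iff.1 hJ h1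
  · intro K hK hKJ
    rw [pd_mul, multiD_evolutionPDE, pd_sub, pd_u, if_neg fun h => hKJ (add_right_cancel h).symm,
      hgpd K hK, hWpd, mul_zero, sub_zero, mul_zero, add_zero]
  · exact fun h => absurd hJ h

/-! ### Adjoint-symmetries and multipliers of `u_t = g` -/

/-- Here `G'* = -D_t - g'*`, with `D_t Q` split by `totalD_zero_eq`. If `g` and `Q` are free of
`t`-derivatives, these enter only through `Q'(G)`. -/
theorem adjoint_frechet_evolutionPDE_app (g Q : DiffFun Ω) :
    (frechet (evolutionPDE g)).adjoint.app Q
      = -(evolD g Q + (frechet g).adjoint.app Q) - (frechet Q).app (evolutionPDE g) := by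
  have h : frechet (u (Finsupp.single 0 1) : DiffFun Ω) = Finsupp.single (Finsupp.single 0 1) 1 :=
    LDO.ext_app fun V => by rw [app_frechet, prX_u, LDO.app_single, one_mul]
  rw [evolutionPDE, frechet_sub, h, LDO.adjoint_sub, LDO.app_sub_left, LDO.app_adjoint_single,
    Finsupp.degree_single, pow_one, neg_smul, one_smul, multiD_single, one_mul, totalD_zero_eq g,
    app_frechet, evolutionPDE]
  abel

/-- Adjoint-symmetries `Q` of `u_t = g` without `t`-derivatives of `u` satisfy
`G'*(Q) = -Q'(G)` identically. -/
theorem adjoint_frechet_app_of_isAdjointSymmetry (hΩ : IsSpatialDomain Ω) {g Q : DiffFun Ω}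
    (hg : IsTFree g) (hQ : IsTFree Q) (hadj : IsAdjointSymmetry (evolutionPDE g) Q) :
    (frechet (evolutionPDE g)).adjoint.app Q = -(frechet Q).app (evolutionPDE g) := by
  have h1 : IsTFree (-(evolD g Q + (frechet g).adjoint.app Q)) := by
    rw [evolD_eq]
    exact (((hQ.pd hΩ _).add (hg.prX hΩ hQ)).add
      (((LDO.isSpatial_frechet hΩ hg).adjoint hΩ).app hΩ hQ)).neg
  have h2 := adjoint_frechet_evolutionPDE_app g Q
  have h3 : VanishesOnSolutions (evolutionPDE g) (-(evolD g Q + (frechet g).adjoint.app Q)) := by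
    rw [sub_eq_iff_eq_add.1 h2.symm]
    exact hadj.add (vanishesOnSolutions_app _ _)
  rw [h2, IsTFree.eq_zero_of_vanishesOnSolutions hΩ hg h1 h3, zero_sub]

/-- Bookkeeping for the next proof: `h` is the linearized identity, `h'` its adjoint, and `l` the
self-adjoint term common to both. -/
theorem sub_add_sub_add_sub_eq_zero {A : Type*} [AddCommGroup A] {l a b c a' b' c' : A}
    (h : l + a = -(c + b)) (h' : l + b' = -(c' + a')) : a - a' + (b - b') + (c - c') = 0 := by
  have h1 : a - a' + (b - b') + (c - c') = (l + a + (c + b)) - (l + b' + (c' + a')) := by abel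
  rw [h1, h, h', neg_add_cancel, neg_add_cancel, sub_self]

/-- For an adjoint-symmetry `Q` and `S = Q' - Q'*`, the identity `G'* S + S G' + pr X_G S = 0`. -/
theorem adjoint_frechet_comp_add_comp_frechet {G Q : DiffFun Ω}
    (h : (frechet G).adjoint.app Q = -(frechet Q).app G) :
    (frechet G).adjoint.comp (frechet Q - (frechet Q).adjoint)
      + (frechet Q - (frechet Q).adjoint).comp (frechet G)
      + (frechet Q - (frechet Q).adjoint).prX G = 0 := by
  have h1 := congrArg frechet h
  rw [frechet_neg, LDO.frechet_app, LDO.frechet_app, LDO.lin_frechet] at h1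
  have h2 := congrArg LDO.adjoint h1
  rw [LDO.adjoint_neg, LDO.adjoint_add, LDO.adjoint_add, LDO.adjoint_comp, LDO.adjoint_comp,
    LDO.adjoint_adjoint, LDO.adjoint_adjoint_frechet_lin, ← LDO.prX_adjoint] at h2
  rw [LDO.comp_sub, LDO.sub_comp, LDO.prX_sub]
  exact sub_add_sub_add_sub_eq_zero (A := LDO Ω) h1 h2

/-- By the product rule `(S(P))' = S.lin P + S P'`, and skewness of `S` turns the adjoint of `S P'`
into `-P'* S`. -/
theorem frechet_skew_app_sub_adjoint (Q P : DiffFun Ω) {S : LDO Ω}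
    (hS : S = frechet Q - (frechet Q).adjoint) :
    frechet (S.app P) - (frechet (S.app P)).adjoint
      = S.prX P + S.comp (frechet P) + (frechet P).adjoint.comp S := by
  have hskew : S.adjoint = -S := by
    rw [hS, LDO.adjoint_sub, LDO.adjoint_adjoint]
    exact (neg_sub (frechet Q) (frechet Q).adjoint).symm
  have hcomp : (frechet P).adjoint.comp (-S) = -(frechet P).adjoint.comp S :=
    LDO.ext_app fun f => by
      simp only [LDO.app_comp, LDO.app_neg_left, LDO.app_neg_right]
  -- The part of `S.lin P` from `Q'*` is self-adjoint and drops out; the part from `Q'` is `pr X_P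
  -- Q'`, whose skew part is `pr X_P S`.
  have hlin : S.lin P - (S.lin P).adjoint = S.prX P := by
    rw [hS, LDO.lin_sub, LDO.adjoint_sub, LDO.adjoint_adjoint_frechet_lin, LDO.lin_frechet,
      LDO.prX_sub, LDO.prX_adjoint]
    abel
  rw [LDO.frechet_app, LDO.adjoint_add, LDO.adjoint_comp, hskew, hcomp, ← hlin]
  abel

/-- `E_u(QG)` is minus the skew part of `Q'` applied to `G`, and that operator is determined by this
value because its coefficients are free of `t`-derivatives. -/
theorem isMultiplier_iff (hΩ : IsSpatialDomain Ω) {g Q : DiffFun Ω}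
    (hg : IsTFree g) (hQ : IsTFree Q) (hadj : IsAdjointSymmetry (evolutionPDE g) Q) :
    IsMultiplier (evolutionPDE g) Q ↔ frechet Q - (frechet Q).adjoint = 0 := by
  have h : euler (Q * evolutionPDE g)
      = -(frechet Q - (frechet Q).adjoint).app (evolutionPDE g) := by
    rw [euler_mul, adjoint_frechet_app_of_isAdjointSymmetry hΩ hg hQ hadj, LDO.app_sub_left]
    abel
  rw [IsMultiplier, h, neg_eq_zero]
  refine ⟨LDO.eq_zero_of_app_evolutionPDE hΩ hg fun J => ?_, fun h => by
    rw [h, LDO.app_zero_left]⟩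
  have hF := LDO.isSpatial_frechet hΩ hQ
  exact ((hF.sub (hF.adjoint hΩ)) J).1

/-- Uniqueness rests on the coefficients of `R` being free of `t`-derivatives: then `R + Q'` kills
`G` only if it is zero. -/
theorem isAdjointSymmetryOp_iff (hΩ : IsSpatialDomain Ω) {g Q : DiffFun Ω}
    (hg : IsTFree g) (hQ : IsTFree Q) (hadj : IsAdjointSymmetry (evolutionPDE g) Q) (R : LDO Ω) :
    IsAdjointSymmetryOp (evolutionPDE g) Q R ↔ R = -frechet Q := by
  have hF := LDO.isSpatial_frechet hΩ hQ
  have h := adjoint_frechet_app_of_isAdjointSymmetry hΩ hg hQ hadj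
  constructor
  · rintro ⟨hR, hRG⟩
    refine eq_neg_of_add_eq_zero_left (a := R) (b := frechet Q) ?_
    refine LDO.eq_zero_of_app_evolutionPDE hΩ hg (fun J => (hR J).add (hF J).1) ?_
    rw [LDO.app_add_left, ← hRG, h, neg_add_cancel]
  · rintro rfl
    exact ⟨fun J => (hF.neg J).1, by rw [h, LDO.app_neg_left]⟩

end Evolution

end EvolutionJet

end

/-! ### Assembly of the theorem -/

theorem theorem4p3 (n : ℕ) (Ω : TopologicalSpace.Opens (EvolutionJet.Jet n))
    (hΩ : EvolutionJet.IsSpatialDomain Ω)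
    (g Q : EvolutionJet.DiffFun Ω)
    (hg : EvolutionJet.IsTFree g) (hQ : EvolutionJet.IsTFree Q)
    (hadj : EvolutionJet.IsAdjointSymmetry (EvolutionJet.evolutionPDE g) Q)
    (hmult : ¬ EvolutionJet.IsMultiplier (EvolutionJet.evolutionPDE g) Q) :
    (∃ R : EvolutionJet.LDO Ω,
      EvolutionJet.IsAdjointSymmetryOp (EvolutionJet.evolutionPDE g) Q R) ∧
    ∀ R S : EvolutionJet.LDO Ω,
      EvolutionJet.IsAdjointSymmetryOp (EvolutionJet.evolutionPDE g) Q R →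
      S = R.adjoint + EvolutionJet.frechet Q →
        (∀ P : EvolutionJet.DiffFun Ω,
          EvolutionJet.IsSymmetry (EvolutionJet.evolutionPDE g) P →
            EvolutionJet.IsAdjointSymmetry (EvolutionJet.evolutionPDE g) (S.app P)) ∧
        S = EvolutionJet.frechet Q - (EvolutionJet.frechet Q).adjoint ∧
        S = -S.adjoint ∧
        ∀ P : EvolutionJet.DiffFun Ω, EvolutionJet.IsTFree P →
          EvolutionJet.IsSymmetry (EvolutionJet.evolutionPDE g) P →
            (EvolutionJet.IsMultiplier (EvolutionJet.evolutionPDE g) (S.app P) ↔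
              S.prX P + S.comp (EvolutionJet.frechet P)
                + (EvolutionJet.frechet P).adjoint.comp S = 0) := by
  open EvolutionJet in
  refine ⟨⟨_, (isAdjointSymmetryOp_iff hΩ hg hQ hadj _).2 rfl⟩, fun R S hR hS => ?_⟩
  rw [(isAdjointSymmetryOp_iff hΩ hg hQ hadj R).1 hR, LDO.adjoint_neg] at hS
  replace hS := hS.trans (neg_add_eq_sub (frechet Q).adjoint (frechet Q))
  have hsym (P : DiffFun Ω) (hP : IsSymmetry (evolutionPDE g) P) :
      IsAdjointSymmetry (evolutionPDE g) (S.app P) := by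
    have h := adjoint_frechet_comp_add_comp_frechet
      (adjoint_frechet_app_of_isAdjointSymmetry hΩ hg hQ hadj)
    rw [← hS, add_assoc] at h
    have h1 := congrArg (fun W : LDO Ω => W.app P) (eq_neg_of_add_eq_zero_left h)
    simp only [LDO.app_comp, LDO.app_neg_left, LDO.app_add_left, app_frechet] at h1
    rw [IsAdjointSymmetry, h1]
    -- `S(G'(P))` vanishes on solutions because `P` is a symmetry, and `(pr X_G S)(P)` because its
    -- coefficients do.
    exact ((VanishesOnSolutions.app hΩ hg hP S).add (vanishesOnSolutions_prX_app S _ P)).neg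
  refine ⟨hsym, hS, ?_, fun P hPt hP => ?_⟩
  · rw [hS, LDO.adjoint_sub, LDO.adjoint_adjoint]
    exact (neg_sub (frechet Q).adjoint (frechet Q)).symm
  · have hF := LDO.isSpatial_frechet hΩ hQ
    have hSP : IsTFree (S.app P) := by
      rw [hS]
      exact (hF.sub (hF.adjoint hΩ)).app hΩ hPt
    rw [isMultiplier_iff hΩ hg hSP (hsym P hP), frechet_skew_app_sub_adjoint Q P hS]
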